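/- Let $K\ge 3$ arms have reward distributions $\nu_1,\dots,\nu_K$ on $[0,1]$ with means $\mu_1,\dots,\mu_K$ and $\mu^*=\max_a\mu_a$; pulling arm $a$ yields a fresh independent reward with law $\nu_a$. Let $2\le M<K$. The algorithm UCB-M (arm memory size $M$) works as follows. The arms are indexed by $1,\dots,K$ through a uniformly random shuffle, and $\hat a$ is initially index $1$. Phase $w=1,2,\dots$ consists of $h_0=\lceil (K-1)/(M-1)\rceil$ sub-phases of $b_w=2^{w-1}M(M+2)$ pulls each. In each sub-phase the arm memory $S$ consists of $\hat a$ and the $M-1$ arms of least index (or all, if fewer remain) that differ from $\hat a$ and have not been in the arm memory earlier in the same phase. UCB1 is run from scratch on $S$ for $b_w$ pulls: every arm of $S$ is first played once, and after $u\ge|S|$ plays of this run the next arm played maximises $\hat\mu_a+\sqrt{2\ln u/n_a}$ over $a\in S$, where $n_a$ and $\hat\mu_a$ are the number of plays and the average reward of $a$ in this run. Then $\hat a$ becomes a most played arm of $S$ in this run, and the next sub-phase begins. The algorithm stops after $T$ pulls. The order of the initial plays is arbitrary, and so is the breaking of ties. There is a universal constant $C>0$ such that, for all such $K$, $M$, $\nu_1,\dots,\nu_K$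 and all $T>KM^2(M+2)$, if $a_t$ denotes the arm pulled at time $t$, then $$R_T^*=T\mu^*-\sum_{t=1}^{T}\mathbb E[\mu_{a_t}]\;\le\; C\left(KM+\frac{K^{3/2}}{M}\sqrt{T\log_2\frac{T}{KM}}\right),$$ where the expectation is over the rewards and the shuffle. -/

import Mathlib

namespace UCBM

/-- Arbitrary rules for breaking ties: `pull n s` is the arm played at time `n` when `s` is the set
of arms that may be played next, and `recommend s c` is the arm recommended at the end of sub-phase
`s` when `c` is the set of most played arms. -/
structure TieRule (K : ℕ) where
  pull : ℕ → Finset (Fin K) → Fin K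
  pull_mem : ∀ (n : ℕ) (s : Finset (Fin K)), s.Nonempty → pull n s ∈ s
  recommend : ℕ → Finset (Fin K) → Fin K
  recommend_mem : ∀ (n : ℕ) (s : Finset (Fin K)), s.Nonempty → recommend n s ∈ s

/-! ### UCB1 on a set of arms, and the most played arm -/

/-- Statistics of one run of UCB1: number of plays and sum of rewards of each arm. -/
structure RunStats (K : ℕ) where
  plays : Fin K → ℕ
  gain : Fin K → ℝ

/-- The upper confidence bound of arm `a` after `u` plays of the run. -/
noncomputable def ucbIndex {K : ℕ} (u : ℕ) (st : RunStats K) (a : Fin K) : ℝ :=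
  st.gain a / (st.plays a : ℝ) + Real.sqrt (2 * Real.log (u : ℝ) / (st.plays a : ℝ))

/-- The arms of `S` that UCB1 may play after `u` plays of the run: an arm not yet played if there is
one, and otherwise an arm of maximal upper confidence bound. -/
noncomputable def ucb1Candidates {K : ℕ} (S : Finset (Fin K)) (u : ℕ) (st : RunStats K) :
    Finset (Fin K) :=
  if (S.filter (fun a => st.plays a = 0)).Nonempty then S.filter (fun a => st.plays a = 0)
  else S.filter (fun a => ∀ c ∈ S, ucbIndex u st c ≤ ucbIndex u st a)

/-- The statistics of UCB1 on `S` after `u` plays, from scratch. Here `Y v a` is the reward that arm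
`a` gives if it is played at step `v` of the run, and only the rewards of played arms are used. -/
noncomputable def ucb1Stats {K : ℕ} (pick : ℕ → Finset (Fin K) → Fin K) (S : Finset (Fin K))
    (Y : ℕ → Fin K → ℝ) : ℕ → RunStats K
  | 0 => ⟨fun _ => 0, fun _ => 0⟩
  | u + 1 =>
    let st := ucb1Stats pick S Y u
    let a := pick u (ucb1Candidates S u st)
    ⟨Function.update st.plays a (st.plays a + 1), Function.update st.gain a (st.gain a + Y u a)⟩

/-- The arm that UCB1 on `S` plays at step `u` (the first step is `u = 0`). -/
noncomputable def ucb1Arm {K : ℕ} (pick : ℕ → Finset (Fin K) → Fin K) (S : Finset (Fin K))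
    (Y : ℕ → Fin K → ℝ) (u : ℕ) : Fin K :=
  pick u (ucb1Candidates S u (ucb1Stats pick S Y u))

/-- The most played arms of `S`. -/
def mostPlayed {K : ℕ} (S : Finset (Fin K)) (st : RunStats K) : Finset (Fin K) :=
  S.filter (fun a => ∀ c ∈ S, st.plays c ≤ st.plays a)

/-! ### The phased algorithm. Sub-phases are numbered `0, 1, 2, …` through all phases. -/

/-- The number of sub-phases in a phase, `⌈(K - 1) / (M - 1)⌉`. -/
def numSub (K M : ℕ) : ℕ := (K - 1) ⌈/⌉ (M - 1)

/-- The number of pulls of sub-phase `s`: `M (M + 2)` in the first phase, doubled at each new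
phase. -/
def subBudget (K M s : ℕ) : ℕ := M * (M + 2) * 2 ^ (s / numSub K M)

/-- The number of pulls made before sub-phase `s`. -/
def subStart (K M s : ℕ) : ℕ := ∑ r ∈ Finset.range s, subBudget K M r

/-- What is known at the start of a sub-phase: the arm forwarded to it, and the arms that were in
arm memory earlier in the same phase. -/
structure SubState (K : ℕ) where
  forwarded : Fin K
  used : Finset (Fin K)

/-- The `m` arms of `U` of least index (all of `U` if it has at most `m` elements). -/
def lowest {K : ℕ} (m : ℕ) (U : Finset (Fin K)) : Finset (Fin K) :=
  U.filter (fun a => (U.filter (fun c => c < a)).card < m)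

/-- The arm memory of a sub-phase: the forwarded arm and the next `M - 1` arms in index order that
are new in this phase (fewer if fewer are left). -/
def memory {K : ℕ} (M : ℕ) (st : SubState K) : Finset (Fin K) :=
  insert st.forwarded (lowest (M - 1) (Finset.univ \ insert st.forwarded st.used))

/-- The state at the start of sub-phase `s`, where `Y t a` is the reward that the arm of index `a`
gives if it is pulled at time `t`. UCB1 is run afresh on the arm memory, and the most played arm is
forwarded. -/
noncomputable def subState {K : ℕ} [NeZero K] (tie : TieRule K) (M : ℕ) (Y : ℕ → Fin K → ℝ) :
    ℕ → SubState K
  | 0 => ⟨0, ∅⟩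
  | s + 1 =>
    let st := subState tie M Y s
    let S := memory M st
    let fin := ucb1Stats (fun u => tie.pull (subStart K M s + u)) S
      (fun u => Y (subStart K M s + u)) (subBudget K M s)
    ⟨tie.recommend s (mostPlayed S fin),
      if (s + 1) % numSub K M = 0 then ∅ else st.used ∪ S⟩

/-- The sub-phase to which time `t` belongs (the first pull is at time `0`). -/
def subAt (K M t : ℕ) : ℕ := Nat.findGreatest (fun s => subStart K M s ≤ t) t

/-- The index of the arm pulled by UCB-M with arm memory size `M` at time `t`. -/
noncomputable def pulledIndex {K : ℕ} [NeZero K] (tie : TieRule K) (M : ℕ) (Y : ℕ → Fin K → ℝ)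
    (t : ℕ) : Fin K :=
  if K ≤ M then ucb1Arm tie.pull Finset.univ Y t
  else
    let s := subAt K M t
    ucb1Arm (fun u => tie.pull (subStart K M s + u)) (memory M (subState tie M Y s))
      (fun u => Y (subStart K M s + u)) (t - subStart K M s)

/-- The arm pulled by UCB-M at time `t` if the shuffle gives index `i` to the arm `σ i` and the
arm `a` gives reward `X t a` if pulled at time `t`. -/
noncomputable def pulledArm {K : ℕ} [NeZero K] (tie : TieRule K) (M : ℕ)
    (σ : Equiv.Perm (Fin K)) (X : ℕ → Fin K → ℝ) (t : ℕ) : Fin K :=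
  σ (pulledIndex tie M (fun v i => X v (σ i)) t)

/-! ### Bandit instances and regret -/

/-- The expected reward of an arm. -/
noncomputable def armMean {K : ℕ} (ν : Fin K → MeasureTheory.Measure ℝ) (a : Fin K) : ℝ :=
  ∫ x, x ∂(ν a)

/-- The family `X` of rewards (`X t a` is the reward of arm `a` if pulled at time `t`) realises the
bandit instance with reward distributions `ν`: independent rewards, `X t a` with law `ν a`. -/
structure IsRewardTable {Ω : Type*} [MeasurableSpace Ω] (P : MeasureTheory.Measure Ω) {K : ℕ}
    (ν : Fin K → MeasureTheory.Measure ℝ) (X : ℕ → Fin K → Ω → ℝ) : Prop where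
  measurable : ∀ (t : ℕ) (a : Fin K), Measurable (X t a)
  law : ∀ (t : ℕ) (a : Fin K), MeasureTheory.Measure.map (X t a) P = ν a
  indep : ProbabilityTheory.iIndepFun (fun (p : ℕ × Fin K) => X p.1 p.2) P

/-- The expected cumulative regret of UCB-M at horizon `T`; the expectation is over the rewards and
over a uniformly random shuffle of the arms, independent of the rewards. -/
noncomputable def regret {Ω : Type*} [MeasurableSpace Ω] (P : MeasureTheory.Measure Ω) {K : ℕ}
    [NeZero K] (ν : Fin K → MeasureTheory.Measure ℝ) (X : ℕ → Fin K → Ω → ℝ) (tie : TieRule K)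
    (M T : ℕ) : ℝ :=
  (T : ℝ) * (⨆ a, armMean ν a) -
    ∑ t ∈ Finset.range T,
      (∑ σ : Equiv.Perm (Fin K),
        ∫ ω, armMean ν (pulledArm tie M σ (fun v a => X v a ω) t) ∂P) / (K.factorial : ℝ)

end UCBM

/-! Compare each pull with the best arm currently in memory. The regret of a pull in sub-phase `s`
is the loss of the memory (optimal mean minus best mean in memory) plus the regret of the UCB1 run
against the best arm of that memory.

Write `h` for the number of sub-phases per phase and `b` for the budget of a sub-phase. Two
estimates for a single run carry the proof. Its regret is of order `√(M b log b)`
(`integral_sum_gap_le`), and its most played arm falls short of the best arm in memory by order `√(M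
log b / b)` in expectation (`integral_gap_mostPlayed_le`). Both are gap-free. They follow from the
usual optimism argument on the event that the empirical means are accurate from step `√b` on; this
event fails with probability at most `18 M / b`, by a supermartingale bound for adaptively sampled
sums.

The loss of the memory is controlled by forwarding. Every arm enters memory in every phase
(`exists_mem_memory`), so the optimal arm was in memory at some sub-phase of the previous phase.
Since then the best mean in memory has dropped, at each sub-phase, by at most the simple regret of
that sub-phase (`mean_sub_bestMean_le`). At most `2h` terms of order `√(M log b / b)` accumulate,
and over `b` pulls they cost order `h √(M b log b)`, which dominates the regret of the run itself.

The budgets double from phase to phase, so summing over sub-phases gives a geometric series of order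
`h² √(M b log b)` with the last budget `b`. The first phase, which has no predecessor, is charged
one per pull and gives the term `K M`. Finally `h` is of order `K / M` and `h b ≤ 2T`, so that `h²
√(M b log b)` is of order `K^{3/2} / M · √(T log b)`, and `log b` is at most a multiple of `log (T /
(K M))` (`schedule_bound`).

The argument works for every fixed order of the arms, so the randomness of the shuffle plays no
role. -/

namespace UCBM

open MeasureTheory ProbabilityTheory
open scoped NNReal

/-! ### Concentration of adaptively sampled sums -/

section Concentration

variable {Ω : Type*} {m0 : MeasurableSpace Ω} {P : Measure Ω} [IsProbabilityMeasure P]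

/-- The exponential supermartingale of an adaptively sampled sum of sub-Gaussian variables. -/
theorem integral_exp_adaptive_le (ℱ : Filtration ℕ m0) {ξ : ℕ → Ω → ℝ} {c : ℝ≥0}
    (hsub : ∀ v, HasSubgaussianMGF (ξ v) c P)
    (hind : ∀ v, Indep (ℱ v) (MeasurableSpace.comap (ξ v) inferInstance) P)
    (hξ : ∀ v, Measurable[ℱ (v + 1)] (ξ v)) {A : ℕ → Set Ω}
    (hA : ∀ v, MeasurableSet[ℱ v] (A v)) {E : Set Ω} (hE : MeasurableSet[ℱ 0] E) (l : ℝ) (u : ℕ) :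
    Integrable (fun ω => E.indicator (fun _ => (1 : ℝ)) ω *
        Real.exp (∑ v ∈ Finset.range u, (A v).indicator (fun ω => l * ξ v ω - c * l ^ 2 / 2) ω)) P ∧
      ∫ ω, E.indicator (fun _ => (1 : ℝ)) ω *
        Real.exp (∑ v ∈ Finset.range u, (A v).indicator (fun ω => l * ξ v ω - c * l ^ 2 / 2) ω) ∂P
        ≤ P.real E := by
  induction u with
  | zero =>
    have hE' : MeasurableSet E := ℱ.le 0 _ hE
    simp only [Finset.range_zero, Finset.sum_empty, Real.exp_zero, mul_one]
    refine ⟨(integrable_const (1 : ℝ)).indicator hE', ?_⟩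
    rw [integral_indicator hE']
    simp
  | succ u ih =>
    set W : Ω → ℝ := fun ω => E.indicator (fun _ => (1 : ℝ)) ω *
        Real.exp (∑ v ∈ Finset.range u, (A v).indicator (fun ω => l * ξ v ω - c * l ^ 2 / 2) ω)
      with hW
    obtain ⟨hint, hle⟩ := ih
    have hAm : MeasurableSet (A u) := ℱ.le u _ (hA u)
    have hWm : Measurable[ℱ u] W := by
      refine Measurable.mul (measurable_const.indicator (ℱ.mono (Nat.zero_le u) _ hE)) ?_
      refine Real.measurable_exp.comp ?_
      refine Finset.measurable_sum _ fun v hv => ?_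
      have hvu : v + 1 ≤ u := Finset.mem_range.1 hv
      refine Measurable.indicator ?_ (ℱ.mono (Nat.le_of_succ_le hvu) _ (hA v))
      exact (((hξ v).mono (ℱ.mono hvu) le_rfl).const_mul l).sub_const _
    have hWA : Measurable[ℱ u] ((A u).indicator W) := hWm.indicator (hA u)
    have hexp : Integrable (fun ω => Real.exp (l * ξ u ω)) P := (hsub u).integrable_exp_mul l
    -- Both the decision to sample at step `u` and the accumulated weight are determined by the
    -- past, so they are independent of `ξ u`.
    have hindf : IndepFun ((A u).indicator W) (fun ω => Real.exp (l * ξ u ω)) P := by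
      have h1 : IndepFun ((A u).indicator W) (ξ u) P := by
        rw [IndepFun_iff_Indep]
        exact indep_of_indep_of_le_left (hind u) hWA.comap_le
      exact h1.comp (φ := id) (ψ := fun x => Real.exp (l * x)) measurable_id (by fun_prop)
    have hprod : Integrable (fun ω => (A u).indicator W ω * Real.exp (l * ξ u ω)) P :=
      hindf.integrable_mul (hint.indicator hAm) hexp
    -- Off `A u` the weight is frozen. On `A u` it is multiplied by a factor independent of the
    -- past, whose mean is at most one by sub-Gaussianity.
    have hsplit : ∀ ω, E.indicator (fun _ => (1 : ℝ)) ω *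
        Real.exp (∑ v ∈ Finset.range (u + 1),
          (A v).indicator (fun ω => l * ξ v ω - c * l ^ 2 / 2) ω) =
        (A u)ᶜ.indicator W ω +
          Real.exp (-(c * l ^ 2 / 2)) * ((A u).indicator W ω * Real.exp (l * ξ u ω)) := by
      intro ω
      rw [Finset.sum_range_succ, Real.exp_add, ← mul_assoc]
      by_cases h : ω ∈ A u
      · have : ω ∉ (A u)ᶜ := fun h' => h' h
        rw [Set.indicator_of_mem h, Set.indicator_of_mem h, Set.indicator_of_notMem this,
          sub_eq_add_neg, Real.exp_add]
        simp only [hW]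
        ring
      · have : ω ∈ (A u)ᶜ := h
        rw [Set.indicator_of_notMem h, Set.indicator_of_notMem h, Set.indicator_of_mem this]
        simp [hW]
    simp only [hsplit]
    have hi1 : Integrable ((A u)ᶜ.indicator W) P := hint.indicator hAm.compl
    refine ⟨hi1.add (hprod.const_mul _), ?_⟩
    rw [integral_add hi1 (hprod.const_mul _), integral_const_mul]
    have hmul : ∫ ω, (A u).indicator W ω * Real.exp (l * ξ u ω) ∂P =
        (∫ ω, (A u).indicator W ω ∂P) * ∫ ω, Real.exp (l * ξ u ω) ∂P :=
      hindf.integral_fun_mul_eq_mul_integral (hint.indicator hAm).aestronglyMeasurable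
        hexp.aestronglyMeasurable
    have hmgf : ∫ ω, Real.exp (l * ξ u ω) ∂P ≤ Real.exp (c * l ^ 2 / 2) := (hsub u).mgf_le l
    have hW0 : ∀ ω, 0 ≤ W ω := fun ω =>
      mul_nonneg (Set.indicator_nonneg (fun _ _ => zero_le_one) _) (Real.exp_pos _).le
    have hA0 : 0 ≤ ∫ ω, (A u).indicator W ω ∂P :=
      integral_nonneg fun ω => Set.indicator_nonneg (fun ω _ => hW0 ω) _
    have hsum : ∫ ω, (A u)ᶜ.indicator W ω ∂P + ∫ ω, (A u).indicator W ω ∂P = ∫ ω, W ω ∂P := by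
      rw [integral_indicator hAm, integral_indicator hAm.compl, add_comm]
      exact integral_add_compl hAm hint
    have hkey : Real.exp (-(c * l ^ 2 / 2)) * (∫ ω, (A u).indicator W ω * Real.exp (l * ξ u ω) ∂P)
        ≤ ∫ ω, (A u).indicator W ω ∂P := by
      rw [hmul]
      calc _ ≤ Real.exp (-(c * l ^ 2 / 2)) *
            ((∫ ω, (A u).indicator W ω ∂P) * Real.exp (c * l ^ 2 / 2)) := by gcongr
        _ = (∫ ω, (A u).indicator W ω ∂P) *
            (Real.exp (-(c * l ^ 2 / 2)) * Real.exp (c * l ^ 2 / 2)) := by ring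
        _ = _ := by rw [← Real.exp_add]; simp
    linarith

/-- Markov's inequality for the exponential supermartingale. -/
theorem measureReal_adaptive_ge_le (ℱ : Filtration ℕ m0) {ξ : ℕ → Ω → ℝ} {c : ℝ≥0}
    (hsub : ∀ v, HasSubgaussianMGF (ξ v) c P)
    (hind : ∀ v, Indep (ℱ v) (MeasurableSpace.comap (ξ v) inferInstance) P)
    (hξ : ∀ v, Measurable[ℱ (v + 1)] (ξ v)) {A : ℕ → Set Ω}
    (hA : ∀ v, MeasurableSet[ℱ v] (A v)) {E : Set Ω} (hE : MeasurableSet[ℱ 0] E) (l θ : ℝ)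
    (u : ℕ) :
    P.real (E ∩ {ω | θ ≤ ∑ v ∈ Finset.range u,
        (A v).indicator (fun ω => l * ξ v ω - c * l ^ 2 / 2) ω}) ≤ Real.exp (-θ) * P.real E := by
  obtain ⟨hint, hle⟩ := integral_exp_adaptive_le (P := P) ℱ hsub hind hξ hA hE l u
  have hmark := mul_meas_ge_le_integral_of_nonneg (μ := P) (Filter.Eventually.of_forall fun ω =>
    mul_nonneg (Set.indicator_nonneg (fun _ _ => zero_le_one) ω) (Real.exp_pos _).le) hint
    (Real.exp θ)
  have hsubset : P.real (E ∩ {ω | θ ≤ ∑ v ∈ Finset.range u,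
        (A v).indicator (fun ω => l * ξ v ω - c * l ^ 2 / 2) ω}) ≤
      P.real {ω | Real.exp θ ≤ E.indicator (fun _ => (1 : ℝ)) ω *
        Real.exp (∑ v ∈ Finset.range u,
          (A v).indicator (fun ω => l * ξ v ω - c * l ^ 2 / 2) ω)} := by
    refine measureReal_mono ?_
    rintro ω ⟨h1, h2⟩
    simp only [Set.mem_ofPred_eq, Set.indicator_of_mem h1, one_mul]
    exact Real.exp_le_exp.2 h2
  have h := (mul_le_mul_of_nonneg_left hsubset (Real.exp_pos θ).le).trans (hmark.trans hle)
  rw [Real.exp_neg, inv_mul_eq_div, le_div_iff₀ (Real.exp_pos θ), mul_comm]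
  exact h

end Concentration

/-! ### Measurability of the algorithm -/

section Measurability

variable {Ω : Type*} [MeasurableSpace Ω] {K : ℕ}

theorem measurable_ucb1Candidates {S : Ω → Finset (Fin K)} (hS : Measurable S) (u : ℕ)
    {st : Ω → RunStats K} (hp : ∀ a, Measurable fun ω => (st ω).plays a)
    (hg : ∀ a, Measurable fun ω => (st ω).gain a) :
    Measurable fun ω => ucb1Candidates (S ω) u (st ω) := by
  have hmem : ∀ a, Measurable fun ω => a ∈ S ω := measurable_finset_iff.1 hS
  have hz : ∀ a, Measurable fun ω => (st ω).plays a = 0 := fun a => (hp a).eq_const 0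
  have hidx : ∀ a, Measurable fun ω => ucbIndex u (st ω) a := by
    intro a
    have h1 : Measurable fun ω => ((st ω).plays a : ℝ) := measurable_from_top.comp (hp a)
    unfold ucbIndex
    exact ((hg a).div h1).add (measurable_const.div h1).sqrt
  refine measurable_finset_iff.2 fun a => ?_
  have heq : (fun ω => a ∈ ucb1Candidates (S ω) u (st ω)) = fun ω =>
      ((∃ c, c ∈ S ω ∧ (st ω).plays c = 0) ∧ a ∈ S ω ∧ (st ω).plays a = 0) ∨
      (¬ (∃ c, c ∈ S ω ∧ (st ω).plays c = 0) ∧ a ∈ S ω ∧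
        ∀ c, c ∈ S ω → ucbIndex u (st ω) c ≤ ucbIndex u (st ω) a) := by
    funext ω
    have hne : ((S ω).filter (fun a => (st ω).plays a = 0)).Nonempty ↔
        ∃ c, c ∈ S ω ∧ (st ω).plays c = 0 := by
      simp [Finset.Nonempty]
    unfold ucb1Candidates
    by_cases h : ∃ c, c ∈ S ω ∧ (st ω).plays c = 0
    · rw [if_pos (hne.2 h)]
      simp [h]
    · rw [if_neg (mt hne.1 h)]
      simp [h]
  rw [heq]
  have hex : Measurable fun ω => ∃ c, c ∈ S ω ∧ (st ω).plays c = 0 :=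
    Measurable.exists fun c => (hmem c).and (hz c)
  refine (hex.and ((hmem a).and (hz a))).or (hex.not.and ((hmem a).and ?_))
  refine Measurable.forall fun c => (hmem c).imp ?_
  exact measurableSet_setOfPred.1 (measurableSet_le (hidx c) (hidx a))

/-- Only rewards before step `u` need to be measurable. Together with the arbitrary σ-algebra on
`Ω`, this allows the lemma to be applied to the σ-algebra of the past, where it expresses that the
algorithm is non-anticipating. -/
theorem measurable_ucb1Stats {pick : ℕ → Finset (Fin K) → Fin K} {S : Ω → Finset (Fin K)}
    (hS : Measurable S) {Y : ℕ → Fin K → Ω → ℝ} (u : ℕ)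
    (hY : ∀ v < u, ∀ a, Measurable (Y v a)) :
    (∀ a, Measurable fun ω => (ucb1Stats pick (S ω) (fun v c => Y v c ω) u).plays a) ∧
      ∀ a, Measurable fun ω => (ucb1Stats pick (S ω) (fun v c => Y v c ω) u).gain a := by
  induction u with
  | zero => exact ⟨fun a => measurable_const, fun a => measurable_const⟩
  | succ u ih =>
    obtain ⟨hp, hg⟩ := ih fun v hv => hY v (hv.trans (Nat.lt_succ_self u))
    have harm : Measurable fun ω => pick u
        (ucb1Candidates (S ω) u (ucb1Stats pick (S ω) (fun v c => Y v c ω) u)) :=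
      (Measurable.of_discrete (f := pick u)).comp (measurable_ucb1Candidates hS u hp hg)
    have heq : ∀ a, MeasurableSet {ω | a = pick u
        (ucb1Candidates (S ω) u (ucb1Stats pick (S ω) (fun v c => Y v c ω) u))} := fun a =>
      measurableSet_setOfPred.2 (harm.const_eq a)
    constructor
    · intro a
      simp only [ucb1Stats, Function.update_apply]
      refine Measurable.ite (heq a) ?_ (hp a)
      -- Evaluation at a random arm is measurable because the arm takes countably many values.
      exact (measurable_from_prod_countable_right (f := fun x : Fin K × (Fin K → ℕ) => x.2 x.1 + 1)
        (fun c => (measurable_pi_apply c).add_const 1)).comp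
        (harm.prodMk (measurable_pi_lambda _ hp))
    · intro a
      simp only [ucb1Stats, Function.update_apply]
      refine Measurable.ite (heq a) ?_ (hg a)
      exact (measurable_from_prod_countable_right
        (f := fun x : Fin K × ((Fin K → ℝ) × (Fin K → ℝ)) => x.2.1 x.1 + x.2.2 x.1)
        (fun c => ((measurable_pi_apply c).comp measurable_fst).add
          ((measurable_pi_apply c).comp measurable_snd))).comp
        (harm.prodMk ((measurable_pi_lambda _ hg).prodMk
          (measurable_pi_lambda _ (hY u (Nat.lt_succ_self u)))))

theorem measurable_ucb1Arm {pick : ℕ → Finset (Fin K) → Fin K} {S : Ω → Finset (Fin K)}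
    (hS : Measurable S) {Y : ℕ → Fin K → Ω → ℝ} (u : ℕ)
    (hY : ∀ v < u, ∀ a, Measurable (Y v a)) :
    Measurable fun ω => ucb1Arm pick (S ω) (fun v c => Y v c ω) u := by
  obtain ⟨hp, hg⟩ := measurable_ucb1Stats (pick := pick) hS u hY
  exact (Measurable.of_discrete (f := pick u)).comp (measurable_ucb1Candidates hS u hp hg)

theorem measurable_mostPlayed {S : Ω → Finset (Fin K)} (hS : Measurable S)
    {st : Ω → RunStats K} (hp : ∀ a, Measurable fun ω => (st ω).plays a) :
    Measurable fun ω => mostPlayed (S ω) (st ω) := by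
  have hmem : ∀ a, Measurable fun ω => a ∈ S ω := measurable_finset_iff.1 hS
  refine measurable_finset_iff.2 fun a => ?_
  simp only [mostPlayed, Finset.mem_filter]
  refine (hmem a).and (Measurable.forall fun c => (hmem c).imp ?_)
  exact measurableSet_setOfPred.1 (measurableSet_le (hp c) (hp a))

/-- The memory of a sub-phase depends only on rewards drawn before the sub-phase begins. The
concentration bounds for its run use this with the σ-algebra of the past. -/
theorem measurable_subState [NeZero K] (tie : TieRule K) (M : ℕ) {Y : ℕ → Fin K → Ω → ℝ} (s : ℕ)
    (hY : ∀ t < subStart K M s, ∀ a, Measurable (Y t a)) :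
    (Measurable fun ω => (subState tie M (fun t c => Y t c ω) s).forwarded) ∧
      (Measurable fun ω => (subState tie M (fun t c => Y t c ω) s).used) ∧
      Measurable fun ω => memory M (subState tie M (fun t c => Y t c ω) s) := by
  have key : ∀ st : Ω → SubState K, (Measurable fun ω => (st ω).forwarded) →
      (Measurable fun ω => (st ω).used) → Measurable fun ω => memory M (st ω) := by
    intro st h1 h2
    have hd : Measurable fun x : Fin K × Finset (Fin K) => memory M ⟨x.1, x.2⟩ :=
      Measurable.of_discrete
    exact hd.comp (f := fun ω => ((st ω).forwarded, (st ω).used)) (h1.prodMk h2)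
  induction s with
  | zero =>
    simp only [subState]
    exact ⟨measurable_const, measurable_const, measurable_const⟩
  | succ s ih =>
    have hstart : subStart K M (s + 1) = subStart K M s + subBudget K M s :=
      Finset.sum_range_succ _ _
    obtain ⟨hf, hu, hm⟩ := ih fun t ht => hY t (by omega)
    obtain ⟨hp, -⟩ := measurable_ucb1Stats (pick := fun u => tie.pull (subStart K M s + u)) hm
      (Y := fun u => Y (subStart K M s + u)) (subBudget K M s)
      (fun v hv a => hY _ (by omega) a)
    have h1 : Measurable fun ω => (subState tie M (fun t c => Y t c ω) (s + 1)).forwarded :=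
      (Measurable.of_discrete (f := tie.recommend s)).comp (measurable_mostPlayed hm hp)
    have h2 : Measurable fun ω => (subState tie M (fun t c => Y t c ω) (s + 1)).used := by
      simp only [subState]
      split_ifs
      · exact measurable_const
      · exact (Measurable.of_discrete
          (f := fun x : Finset (Fin K) × Finset (Fin K) => x.1 ∪ x.2)).comp (hu.prodMk hm)
    exact ⟨h1, h2, key _ h1 h2⟩

end Measurability

/-! ### One run of UCB1 with accurate empirical means -/

section Run

variable {K : ℕ} {pick : ℕ → Finset (Fin K) → Fin K} {S : Finset (Fin K)} {Y : ℕ → Fin K → ℝ}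

theorem ucb1Candidates_subset (S : Finset (Fin K)) (u : ℕ) (st : RunStats K) :
    ucb1Candidates S u st ⊆ S := by
  unfold ucb1Candidates
  split_ifs <;> exact Finset.filter_subset _ _

theorem ucb1Candidates_nonempty (hS : S.Nonempty) (u : ℕ) (st : RunStats K) :
    (ucb1Candidates S u st).Nonempty := by
  unfold ucb1Candidates
  split_ifs with h
  · exact h
  · obtain ⟨a, ha, hmax⟩ := S.exists_max_image (ucbIndex u st) hS
    exact ⟨a, Finset.mem_filter.2 ⟨ha, hmax⟩⟩

theorem ucb1Arm_mem_candidates (hpick : ∀ n s, s.Nonempty → pick n s ∈ s) (hS : S.Nonempty)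
    (Y : ℕ → Fin K → ℝ) (u : ℕ) :
    ucb1Arm pick S Y u ∈ ucb1Candidates S u (ucb1Stats pick S Y u) :=
  hpick _ _ (ucb1Candidates_nonempty hS _ _)

theorem ucb1Arm_mem (hpick : ∀ n s, s.Nonempty → pick n s ∈ s) (hS : S.Nonempty)
    (Y : ℕ → Fin K → ℝ) (u : ℕ) : ucb1Arm pick S Y u ∈ S :=
  ucb1Candidates_subset _ _ _ (ucb1Arm_mem_candidates hpick hS Y u)

theorem plays_succ (pick : ℕ → Finset (Fin K) → Fin K) (S : Finset (Fin K)) (Y : ℕ → Fin K → ℝ)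
    (u : ℕ) (a : Fin K) :
    (ucb1Stats pick S Y (u + 1)).plays a = (ucb1Stats pick S Y u).plays a +
      if ucb1Arm pick S Y u = a then 1 else 0 := by
  have hupd : (ucb1Stats pick S Y (u + 1)).plays = Function.update (ucb1Stats pick S Y u).plays
      (ucb1Arm pick S Y u) ((ucb1Stats pick S Y u).plays (ucb1Arm pick S Y u) + 1) := rfl
  rw [hupd, Function.update_apply]
  by_cases h : a = ucb1Arm pick S Y u
  · rw [if_pos h, if_pos h.symm, h]
  · rw [if_neg h, if_neg (Ne.symm h), add_zero]

theorem gain_succ (pick : ℕ → Finset (Fin K) → Fin K) (S : Finset (Fin K)) (Y : ℕ → Fin K → ℝ)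
    (u : ℕ) (a : Fin K) :
    (ucb1Stats pick S Y (u + 1)).gain a = (ucb1Stats pick S Y u).gain a +
      if ucb1Arm pick S Y u = a then Y u a else 0 := by
  have hupd : (ucb1Stats pick S Y (u + 1)).gain = Function.update (ucb1Stats pick S Y u).gain
      (ucb1Arm pick S Y u) ((ucb1Stats pick S Y u).gain (ucb1Arm pick S Y u) + Y u (ucb1Arm pick S Y u)) := rfl
  rw [hupd, Function.update_apply]
  by_cases h : a = ucb1Arm pick S Y u
  · rw [if_pos h, if_pos h.symm, h]
  · rw [if_neg h, if_neg (Ne.symm h), add_zero]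

/-- A linear combination of the gain and the number of plays of an arm, as an adaptive sum. -/
theorem gain_add_plays_eq_sum (pick : ℕ → Finset (Fin K) → Fin K) (S : Finset (Fin K))
    (Y : ℕ → Fin K → ℝ) (u : ℕ) (a : Fin K) (l μ d : ℝ) :
    l * ((ucb1Stats pick S Y u).gain a - μ * (ucb1Stats pick S Y u).plays a) -
        d * (ucb1Stats pick S Y u).plays a =
      ∑ v ∈ Finset.range u, if ucb1Arm pick S Y v = a then l * (Y v a - μ) - d else 0 := by
  induction u with
  | zero => simp [ucb1Stats]
  | succ u ih =>
    rw [Finset.sum_range_succ, ← ih, plays_succ, gain_succ]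
    split_ifs
    · push_cast; ring
    · push_cast; ring

theorem sum_plays (hpick : ∀ n s, s.Nonempty → pick n s ∈ s) (hS : S.Nonempty)
    (Y : ℕ → Fin K → ℝ) (u : ℕ) : ∑ a ∈ S, (ucb1Stats pick S Y u).plays a = u := by
  induction u with
  | zero => simp [ucb1Stats]
  | succ u ih =>
    simp only [plays_succ, Finset.sum_add_distrib, ih]
    rw [Finset.sum_ite_eq S, if_pos (ucb1Arm_mem hpick hS Y u)]

theorem plays_le (pick : ℕ → Finset (Fin K) → Fin K) (S : Finset (Fin K)) (Y : ℕ → Fin K → ℝ)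
    (u : ℕ) (a : Fin K) : (ucb1Stats pick S Y u).plays a ≤ u := by
  induction u with
  | zero => simp [ucb1Stats]
  | succ u ih =>
    rw [plays_succ]
    split_ifs <;> omega

/-- As long as some arm is unplayed, no arm has been played twice, so fewer than `S.card` plays have
been made. -/
theorem one_le_plays (hpick : ∀ n s, s.Nonempty → pick n s ∈ s) (Y : ℕ → Fin K → ℝ) {u : ℕ}
    (hu : S.card ≤ u) {a : Fin K} (ha : a ∈ S) : 1 ≤ (ucb1Stats pick S Y u).plays a := by
  have hS : S.Nonempty := ⟨a, ha⟩
  have key : ∀ u, (∃ c ∈ S, (ucb1Stats pick S Y u).plays c = 0) →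
      ∀ c ∈ S, (ucb1Stats pick S Y u).plays c ≤ 1 := by
    intro u
    induction u with
    | zero => intro _ c _; simp [ucb1Stats]
    | succ u ih =>
      rintro ⟨c, hc, hc0⟩ d hd
      have hcu : (ucb1Stats pick S Y u).plays c = 0 := by rw [plays_succ] at hc0; omega
      have hle := ih ⟨c, hc, hcu⟩ d hd
      rw [plays_succ]
      split_ifs with h
      · have hmem := ucb1Arm_mem_candidates hpick hS Y u
        unfold ucb1Candidates at hmem
        rw [if_pos ⟨c, Finset.mem_filter.2 ⟨hc, hcu⟩⟩, h] at hmem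
        rw [(Finset.mem_filter.1 hmem).2]
      · exact hle
  by_contra h0
  have ha0 : (ucb1Stats pick S Y u).plays a = 0 := by omega
  have hlt : ∑ c ∈ S, (ucb1Stats pick S Y u).plays c < ∑ c ∈ S, 1 :=
    Finset.sum_lt_sum (key u ⟨a, ha, ha0⟩) ⟨a, ha, by omega⟩
  rw [sum_plays hpick hS, Finset.sum_const, smul_eq_mul, mul_one] at hlt
  omega

theorem exists_play_of_lt_plays (pick : ℕ → Finset (Fin K) → Fin K) (S : Finset (Fin K))
    (Y : ℕ → Fin K → ℝ) {b n : ℕ} {a : Fin K} (h : n < (ucb1Stats pick S Y b).plays a) :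
    ∃ u < b, ucb1Arm pick S Y u = a ∧ (ucb1Stats pick S Y u).plays a = n := by
  induction b with
  | zero => simp [ucb1Stats] at h
  | succ b ih =>
    by_cases h' : n < (ucb1Stats pick S Y b).plays a
    · obtain ⟨u, hu, h1⟩ := ih h'
      exact ⟨u, hu.trans (Nat.lt_succ_self b), h1⟩
    · rw [plays_succ] at h
      by_cases harm : ucb1Arm pick S Y b = a
      · rw [if_pos harm] at h
        exact ⟨b, Nat.lt_succ_self b, harm, by omega⟩
      · rw [if_neg harm] at h
        omega

/-- After `u` plays, the empirical means of the arms of `S` are close to their means `μ`. -/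
def Accurate (pick : ℕ → Finset (Fin K) → Fin K) (S : Finset (Fin K)) (Y : ℕ → Fin K → ℝ)
    (μ : Fin K → ℝ) (u : ℕ) : Prop :=
  ∀ a ∈ S, 1 ≤ (ucb1Stats pick S Y u).plays a →
    |(ucb1Stats pick S Y u).gain a - μ a * (ucb1Stats pick S Y u).plays a| ≤
      Real.sqrt (2 * Real.log u * (ucb1Stats pick S Y u).plays a)

variable {μ : Fin K → ℝ}

/-- Optimism: accuracy makes the index of `c` at least its mean, the played arm has the larger
index, and that index exceeds the mean of the played arm by at most twice its confidence radius. -/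
theorem gap_le_of_accurate (hpick : ∀ n s, s.Nonempty → pick n s ∈ s) {u : ℕ}
    (hu : S.card ≤ u) (hacc : Accurate pick S Y μ u) {c : Fin K} (hc : c ∈ S) :
    μ c - μ (ucb1Arm pick S Y u) ≤ 2 * Real.sqrt (2 * Real.log u) /
      Real.sqrt ((ucb1Stats pick S Y u).plays (ucb1Arm pick S Y u)) := by
  have hS : S.Nonempty := ⟨c, hc⟩
  set st := ucb1Stats pick S Y u with hst
  set a := ucb1Arm pick S Y u with ha
  have hmem := ucb1Arm_mem_candidates hpick hS Y u
  have hall : ∀ d ∈ S, 1 ≤ st.plays d := fun d hd => one_le_plays hpick Y hu hd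
  have hne : ¬ (S.filter (fun d => st.plays d = 0)).Nonempty := by
    rintro ⟨d, hd⟩
    have h1 := hall d (Finset.mem_filter.1 hd).1
    have h2 := (Finset.mem_filter.1 hd).2
    omega
  unfold ucb1Candidates at hmem
  rw [← hst, if_neg hne, ← ha] at hmem
  obtain ⟨haS, hmax⟩ := Finset.mem_filter.1 hmem
  have hlog : 0 ≤ 2 * Real.log (u : ℝ) := mul_nonneg zero_le_two (Real.log_natCast_nonneg u)
  have hdev : ∀ d ∈ S, |st.gain d / st.plays d - μ d| ≤
      Real.sqrt (2 * Real.log u) / Real.sqrt (st.plays d) := by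
    intro d hd
    have hn : (0 : ℝ) < st.plays d := by exact_mod_cast hall d hd
    have h := hacc d hd (hall d hd)
    rw [Real.sqrt_mul hlog] at h
    have h1 : st.gain d / st.plays d - μ d = (st.gain d - μ d * st.plays d) / st.plays d := by
      field_simp
    rw [h1, abs_div, abs_of_pos hn, div_le_div_iff₀ hn (Real.sqrt_pos.2 hn)]
    calc _ ≤ (Real.sqrt (2 * Real.log u) * Real.sqrt (st.plays d)) * Real.sqrt (st.plays d) :=
          mul_le_mul_of_nonneg_right h (Real.sqrt_nonneg _)
      _ = _ := by rw [mul_assoc, Real.mul_self_sqrt hn.le]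
  have h1 := hmax c hc
  unfold ucbIndex at h1
  rw [Real.sqrt_div hlog, Real.sqrt_div hlog] at h1
  have h2 := (abs_le.1 (hdev c hc)).1
  have h3 := (abs_le.1 (hdev a haS)).2
  have h4 : 2 * Real.sqrt (2 * Real.log u) / Real.sqrt (st.plays a) =
    Real.sqrt (2 * Real.log u) / Real.sqrt (st.plays a) +
    Real.sqrt (2 * Real.log u) / Real.sqrt (st.plays a) := by ring
  linarith

theorem one_div_sqrt_le {n : ℕ} (hn : 1 ≤ n) :
    1 / Real.sqrt n ≤ 3 * (Real.sqrt ((n : ℝ) + 1) - Real.sqrt n) := by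
  have h1 : (1 : ℝ) ≤ n := by exact_mod_cast hn
  have hs : 0 < Real.sqrt n := Real.sqrt_pos.2 (by linarith)
  have hsq : Real.sqrt n ^ 2 = n := Real.sq_sqrt (by linarith)
  have hsq' : Real.sqrt ((n : ℝ) + 1) ^ 2 = n + 1 := Real.sq_sqrt (by linarith)
  have hle : Real.sqrt ((n : ℝ) + 1) ≤ 2 * Real.sqrt n := by
    rw [Real.sqrt_le_left (by positivity)]
    nlinarith
  have hmono : Real.sqrt n ≤ Real.sqrt ((n : ℝ) + 1) := Real.sqrt_le_sqrt (by linarith)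
  rw [div_le_iff₀ hs]
  nlinarith

/-- The gap-free bound on the regret of a run of UCB1 on an arm memory of at most `M` arms. -/
theorem sum_gap_le_potential (hpick : ∀ n s, s.Nonempty → pick n s ∈ s) (hμ : ∀ a, 0 ≤ μ a)
    (hμ' : ∀ a, μ a ≤ 1) {b : ℕ} (hcard : S.card * S.card ≤ b)
    (hacc : ∀ u < b, b ≤ u * u → Accurate pick S Y μ u) {c : Fin K} (hc : c ∈ S) {t : ℕ}
    (ht : t ≤ b) :
    ∑ v ∈ Finset.range t, (μ c - μ (ucb1Arm pick S Y v)) ≤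
      (((Finset.range t).filter (fun v => v * v < b)).card : ℝ) +
        6 * Real.sqrt (2 * Real.log b) *
          ∑ a ∈ S, Real.sqrt ((ucb1Stats pick S Y t).plays a) := by
  induction t with
  | zero => simp [ucb1Stats]
  | succ t ih =>
    have hS : S.Nonempty := ⟨c, hc⟩
    have ih := ih (by omega)
    set a := ucb1Arm pick S Y t with ha
    have haS : a ∈ S := ucb1Arm_mem hpick hS Y t
    -- Only the count of the played arm changes. The growth of its square root pays for the
    -- confidence radius at this step, up to a constant.
    have hpot : ∑ d ∈ S, Real.sqrt ((ucb1Stats pick S Y (t + 1)).plays d) =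
        ∑ d ∈ S, Real.sqrt ((ucb1Stats pick S Y t).plays d) +
          (Real.sqrt ((ucb1Stats pick S Y t).plays a + 1) -
            Real.sqrt ((ucb1Stats pick S Y t).plays a)) := by
      rw [← Finset.add_sum_erase S _ haS, ← Finset.add_sum_erase S
        (fun d => Real.sqrt ((ucb1Stats pick S Y t).plays d)) haS]
      have : ∑ d ∈ S.erase a, Real.sqrt ((ucb1Stats pick S Y (t + 1)).plays d) =
          ∑ d ∈ S.erase a, Real.sqrt ((ucb1Stats pick S Y t).plays d) := by
        refine Finset.sum_congr rfl fun d hd => ?_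
        rw [plays_succ, if_neg (Finset.ne_of_mem_erase hd).symm, add_zero]
      rw [this, plays_succ, if_pos ha.symm]
      push_cast
      ring
    have hL : 0 ≤ Real.sqrt (2 * Real.log b) := Real.sqrt_nonneg _
    have hinc : 0 ≤ Real.sqrt ((ucb1Stats pick S Y t).plays a + 1) -
        Real.sqrt ((ucb1Stats pick S Y t).plays a) :=
      sub_nonneg.2 (Real.sqrt_le_sqrt (by linarith))
    rw [Finset.sum_range_succ, hpot, Finset.range_add_one, Finset.filter_insert]
    -- Accuracy is not assumed in the first `√b` steps, each of which is charged one. After them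
    -- `hcard` guarantees that every arm has been played.
    by_cases htb : t * t < b
    · rw [if_pos htb, Finset.card_insert_of_notMem (by simp)]
      push_cast
      have := hμ a
      have := hμ' c
      have := mul_nonneg hL hinc
      nlinarith
    · rw [if_neg htb]
      have htb' : b ≤ t * t := not_lt.1 htb
      have hcu : S.card ≤ t := Nat.mul_self_le_mul_self_iff.1 (hcard.trans htb')
      have hgap := gap_le_of_accurate hpick hcu (hacc t (by omega) htb') hc
      rw [← ha] at hgap
      have hn := one_le_plays hpick Y hcu haS
      have hpos : 0 < S.card := hS.card_pos
      have hlog : Real.sqrt (2 * Real.log t) ≤ Real.sqrt (2 * Real.log b) := by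
        refine Real.sqrt_le_sqrt (mul_le_mul_of_nonneg_left ?_ zero_le_two)
        exact Real.log_le_log (by exact_mod_cast (by omega : 0 < t))
          (by exact_mod_cast (by omega : t ≤ b))
      have h1 := one_div_sqrt_le hn
      have h2 : 2 * Real.sqrt (2 * Real.log t) / Real.sqrt ((ucb1Stats pick S Y t).plays a) ≤
          6 * Real.sqrt (2 * Real.log b) * (Real.sqrt ((ucb1Stats pick S Y t).plays a + 1) -
            Real.sqrt ((ucb1Stats pick S Y t).plays a)) := by
        calc _ = 2 * Real.sqrt (2 * Real.log t) *
              (1 / Real.sqrt ((ucb1Stats pick S Y t).plays a)) := by ring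
          _ ≤ 2 * Real.sqrt (2 * Real.log b) *
              (3 * (Real.sqrt ((ucb1Stats pick S Y t).plays a + 1) -
            Real.sqrt ((ucb1Stats pick S Y t).plays a))) := by gcongr
          _ = _ := by ring
      linarith

theorem card_filter_mul_self_lt_le (t b : ℕ) :
    (((Finset.range t).filter (fun v => v * v < b)).card : ℝ) ≤ Real.sqrt b + 1 := by
  have h : (Finset.range t).filter (fun v => v * v < b) ⊆ Finset.range (Nat.sqrt b + 1) := by
    intro v hv
    have := (Finset.mem_filter.1 hv).2
    exact Finset.mem_range.2 (Nat.lt_succ_of_le (Nat.le_sqrt.2 this.le))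
  calc (((Finset.range t).filter (fun v => v * v < b)).card : ℝ) ≤ ((Nat.sqrt b + 1 : ℕ) : ℝ) := by
        exact_mod_cast (Finset.card_le_card h).trans (Finset.card_range _).le
    _ ≤ _ := by
        push_cast
        have := Real.nat_sqrt_le_real_sqrt (a := b)
        linarith

/-- Cauchy–Schwarz bounds the potential by `√(M b)`. The constant is `2 + 6 * 2`: the first `√b + 1`
steps give 2, the potential gives the rest. -/
theorem sum_gap_le (hpick : ∀ n s, s.Nonempty → pick n s ∈ s) (hμ : ∀ a, 0 ≤ μ a)
    (hμ' : ∀ a, μ a ≤ 1) {b M : ℕ} (hM : S.card ≤ M) (hb : M * M ≤ b) (hb2 : 3 ≤ b)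
    (hacc : ∀ u < b, b ≤ u * u → Accurate pick S Y μ u) {c : Fin K} (hc : c ∈ S) {t : ℕ}
    (ht : t ≤ b) :
    ∑ v ∈ Finset.range t, (μ c - μ (ucb1Arm pick S Y v)) ≤
      14 * Real.sqrt (M * b * Real.log b) := by
  have hS : S.Nonempty := ⟨c, hc⟩
  have hM1 : (1 : ℝ) ≤ M := by exact_mod_cast hS.card_pos.trans_le hM
  have hbR : (3 : ℝ) ≤ b := by exact_mod_cast hb2
  have hlog : 1 ≤ Real.log b := by
    rw [Real.le_log_iff_exp_le (by linarith)]
    exact (Real.exp_one_lt_d9.le).trans (by linarith)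
  have h1 := sum_gap_le_potential hpick hμ hμ' ((Nat.mul_le_mul hM hM).trans hb) hacc hc ht
  have h2 := card_filter_mul_self_lt_le t b
  have h3 : ∑ a ∈ S, Real.sqrt ((ucb1Stats pick S Y t).plays a) ≤ Real.sqrt (M * b) := by
    have h := Real.sum_sqrt_mul_sqrt_le S (f := fun _ => (1 : ℝ))
      (g := fun a => ((ucb1Stats pick S Y t).plays a : ℝ)) (fun _ => zero_le_one)
      (fun _ => Nat.cast_nonneg _)
    simp only [Real.sqrt_one, one_mul] at h
    refine h.trans ?_
    rw [← Real.sqrt_mul (by positivity)]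
    refine Real.sqrt_le_sqrt ?_
    rw [← Nat.cast_sum, sum_plays hpick hS]
    have : (S.card : ℝ) ≤ M := by exact_mod_cast hM
    have : (t : ℝ) ≤ b := by exact_mod_cast ht
    simp only [Finset.sum_const, nsmul_eq_mul, mul_one]
    gcongr
  have h4 : Real.sqrt (2 * Real.log b) * Real.sqrt (M * b) ≤
      2 * Real.sqrt (M * b * Real.log b) := by
    rw [← Real.sqrt_mul (by positivity), Real.sqrt_le_left (by positivity), mul_pow,
      Real.sq_sqrt (by positivity)]
    have : 0 ≤ (M : ℝ) * b * Real.log b := by positivity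
    nlinarith
  have h5 : Real.sqrt b ≤ Real.sqrt (M * b * Real.log b) := by
    refine Real.sqrt_le_sqrt ?_
    calc (b : ℝ) = 1 * b * 1 := by ring
      _ ≤ M * b * Real.log b := by gcongr
  have h6 : 1 ≤ Real.sqrt b := Real.one_le_sqrt.2 (by linarith)
  have h7 := mul_le_mul_of_nonneg_left h3 (Real.sqrt_nonneg (2 * Real.log b))
  nlinarith

/-- The most played arm of a run of UCB1 is nearly optimal. -/
theorem gap_mostPlayed_le (hpick : ∀ n s, s.Nonempty → pick n s ∈ s) {b M x : ℕ}
    (hM : S.card ≤ M) (hx : M + 2 ≤ x) (hb : b = M * x)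
    (hacc : ∀ u < b, b ≤ u * u → Accurate pick S Y μ u) {c : Fin K} (hc : c ∈ S) {a : Fin K}
    (ha : a ∈ mostPlayed S (ucb1Stats pick S Y b)) :
    μ c - μ a ≤ 4 * Real.sqrt (M * Real.log b / b) := by
  have hS : S.Nonempty := ⟨c, hc⟩
  have hM0 : 0 < M := hS.card_pos.trans_le hM
  obtain ⟨haS, hmax⟩ := Finset.mem_filter.1 ha
  have hn : x ≤ (ucb1Stats pick S Y b).plays a := by
    have h1 : b ≤ S.card * (ucb1Stats pick S Y b).plays a := by
      calc b = ∑ d ∈ S, (ucb1Stats pick S Y b).plays d := (sum_plays hpick hS Y b).symm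
        _ ≤ ∑ d ∈ S, (ucb1Stats pick S Y b).plays a := Finset.sum_le_sum hmax
        _ = _ := by simp
    have h2 : M * x ≤ M * (ucb1Stats pick S Y b).plays a :=
      hb ▸ h1.trans (Nat.mul_le_mul_right _ hM)
    exact Nat.le_of_mul_le_mul_left h2 hM0
  obtain ⟨y, rfl⟩ : ∃ y, x = y + 1 := ⟨x - 1, by omega⟩
  -- The last play of the most played arm: UCB1 still preferred it although it already had many
  -- plays, so its gap is small.
  obtain ⟨u, hub, harm, hpl⟩ := exists_play_of_lt_plays pick S Y
    (show (ucb1Stats pick S Y b).plays a - 1 < (ucb1Stats pick S Y b).plays a by omega)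
  have hyu : y ≤ u := by
    have := plays_le pick S Y u a
    omega
  -- The condition `M + 2 ≤ x`, hence the factor `M + 2` in the budget, ensures that this last play
  -- falls among the steps where accuracy is available.
  have hbu : b ≤ u * u := by
    have h1 : M * (y + 1) ≤ y * y := by
      have : M ≤ y - 1 := by omega
      obtain ⟨z, rfl⟩ : ∃ z, y = z + 1 := ⟨y - 1, by omega⟩
      calc M * (z + 1 + 1) ≤ z * (z + 1 + 1) := Nat.mul_le_mul_right _ (by omega)
        _ ≤ (z + 1) * (z + 1) := by nlinarith
    rw [hb]
    exact h1.trans (Nat.mul_le_mul hyu hyu)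
  have hgap := gap_le_of_accurate hpick (by omega) (hacc u hub hbu) hc
  rw [harm, hpl] at hgap
  refine hgap.trans ?_
  have hypos : (1 : ℝ) ≤ y := by exact_mod_cast (by omega : 1 ≤ y)
  have hny : (y : ℝ) ≤ ((ucb1Stats pick S Y b).plays a - 1 : ℕ) := by
    exact_mod_cast (by omega : y ≤ (ucb1Stats pick S Y b).plays a - 1)
  have hMR : (0 : ℝ) < M := by exact_mod_cast hM0
  have hlogb : 0 ≤ Real.log b := Real.log_natCast_nonneg b
  calc 2 * Real.sqrt (2 * Real.log u) / Real.sqrt ((ucb1Stats pick S Y b).plays a - 1 : ℕ)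
      ≤ 2 * Real.sqrt (2 * Real.log b) / Real.sqrt y := by
        have : Real.log u ≤ Real.log b := Real.log_le_log
          (by exact_mod_cast (by omega : 0 < u)) (by exact_mod_cast hub.le)
        have : 0 < Real.sqrt y := Real.sqrt_pos.2 (by linarith)
        gcongr
    _ = 2 * Real.sqrt (2 * Real.log b / y) := by
        rw [Real.sqrt_div (by positivity)]; ring
    _ ≤ 2 * Real.sqrt (2 ^ 2 * (M * Real.log b / b)) := by
        refine mul_le_mul_of_nonneg_left (Real.sqrt_le_sqrt ?_) zero_le_two
        rw [hb]
        push_cast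
        rw [mul_div_mul_left _ _ hMR.ne', mul_div_assoc', div_le_div_iff₀ (by linarith)
          (by linarith)]
        have hlog' : 0 ≤ Real.log (M * (y + 1)) := by simpa [hb] using hlogb
        nlinarith
    _ = 4 * Real.sqrt (M * Real.log b / b) := by
        rw [Real.sqrt_mul (by positivity), Real.sqrt_sq zero_le_two]; ring

end Run

/-! ### Expected regret of a run of UCB1 on a random arm memory -/

/-- Telescoping, since `1 / (t + 1)^3 ≤ 1 / t^2 - 1 / (t + 1)^2`. -/
theorem sum_one_div_cube_le {p t : ℕ} (hp : 1 ≤ p) (ht : p ≤ t) :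
    ∑ u ∈ Finset.Ico p t, 1 / ((u : ℝ) + 1) ^ 3 ≤ 1 / (p : ℝ) ^ 2 - 1 / (t : ℝ) ^ 2 := by
  induction t, ht using Nat.le_induction with
  | base => simp
  | succ t ht ih =>
    rw [Finset.sum_Ico_succ_top ht]
    have ht1 : (1 : ℝ) ≤ t := by exact_mod_cast hp.trans ht
    have h : 1 / ((t : ℝ) + 1) ^ 3 ≤ 1 / (t : ℝ) ^ 2 - 1 / ((t : ℝ) + 1) ^ 2 := by
      rw [div_sub_div _ _ (by positivity) (by positivity), div_le_div_iff₀ (by positivity)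
        (by positivity)]
      have : 0 ≤ ((t : ℝ) + 1) ^ 2 := by positivity
      nlinarith [mul_nonneg this (by positivity : 0 ≤ (t : ℝ) ^ 2 + 3 * t + 1)]
    push_cast
    linarith

theorem sum_filter_one_div_cube_le {b : ℕ} (hb : 4 ≤ b) :
    ∑ u ∈ (Finset.range b).filter (fun u => b ≤ u * u), 1 / (u : ℝ) ^ 3 ≤ 9 / (b : ℝ) := by
  have hr : 2 ≤ Nat.sqrt b := Nat.le_sqrt.2 hb
  obtain ⟨p, hp⟩ : ∃ p, Nat.sqrt b = p + 1 := ⟨Nat.sqrt b - 1, by omega⟩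
  have hp1 : 1 ≤ p := by omega
  have hsub : (Finset.range b).filter (fun u => b ≤ u * u) ⊆
      (Finset.Ico p b).image Nat.succ := by
    intro u hu
    obtain ⟨h1, h2⟩ := Finset.mem_filter.1 hu
    have h3 : Nat.sqrt b * Nat.sqrt b ≤ u * u := (Nat.sqrt_le b).trans h2
    have h4 : p + 1 ≤ u := hp ▸ Nat.mul_self_le_mul_self_iff.1 h3
    have h5 := Finset.mem_range.1 h1
    exact Finset.mem_image.2 ⟨u - 1, Finset.mem_Ico.2 ⟨by omega, by omega⟩, by omega⟩
  have hpb : p ≤ b := by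
    have := Nat.sqrt_le_self b
    omega
  calc ∑ u ∈ (Finset.range b).filter (fun u => b ≤ u * u), 1 / (u : ℝ) ^ 3
      ≤ ∑ u ∈ (Finset.Ico p b).image Nat.succ, 1 / (u : ℝ) ^ 3 :=
        Finset.sum_le_sum_of_subset_of_nonneg hsub fun _ _ _ => by positivity
    _ = ∑ u ∈ Finset.Ico p b, 1 / ((u : ℝ) + 1) ^ 3 := by
        rw [Finset.sum_image (fun _ _ _ _ h => Nat.succ_injective h)]
        push_cast [Nat.succ_eq_add_one]
        rfl
    _ ≤ 1 / (p : ℝ) ^ 2 - 1 / (b : ℝ) ^ 2 := sum_one_div_cube_le hp1 hpb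
    _ ≤ 1 / (p : ℝ) ^ 2 := sub_le_self _ (by positivity)
    _ ≤ 9 / b := by
        have hb0 : (0 : ℝ) < b := by exact_mod_cast (by omega : 0 < b)
        have hp0 : (1 : ℝ) ≤ p := by exact_mod_cast hp1
        have hlt : b < (p + 2) * (p + 2) := by
          have := Nat.lt_succ_sqrt b
          rwa [hp] at this
        have hlt' : (b : ℝ) < (p + 2) * (p + 2) := by exact_mod_cast hlt
        rw [div_le_div_iff₀ (by positivity) hb0]
        nlinarith

section ExpectedRun

variable {Ω : Type*} {m0 : MeasurableSpace Ω} {P : Measure Ω} [IsProbabilityMeasure P]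

theorem integral_le_add_measureReal {f : Ω → ℝ} (hf : Integrable f P) {N : Set Ω} {B D : ℝ}
    (hB0 : 0 ≤ B) (hB : ∀ ω, ω ∉ N → f ω ≤ B) (hD : ∀ ω, f ω ≤ D) :
    ∫ ω, f ω ∂P ≤ B + D * P.real N := by
  -- Passing to the measurable hull avoids any measurability requirement on the exceptional set.
  have hm := measurableSet_toMeasurable P N
  have hi : Integrable ((toMeasurable P N).indicator fun _ => D) P :=
    (integrable_const D).indicator hm
  have hle : ∀ ω, f ω ≤ B + (toMeasurable P N).indicator (fun _ => D) ω := by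
    intro ω
    by_cases h : ω ∈ toMeasurable P N
    · rw [Set.indicator_of_mem h]
      linarith [hD ω]
    · rw [Set.indicator_of_notMem h, add_zero]
      exact hB ω fun h' => h (subset_toMeasurable P N h')
  calc ∫ ω, f ω ∂P ≤ ∫ ω, (B + (toMeasurable P N).indicator (fun _ => D) ω) ∂P :=
        integral_mono hf ((integrable_const B).add hi) hle
    _ = B + D * P.real N := by
        rw [integral_add (integrable_const B) hi, integral_indicator hm]
        simp [Measure.real, mul_comm]

variable {K : ℕ} {pick : ℕ → Finset (Fin K) → Fin K} {S : Ω → Finset (Fin K)}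
  {Y : ℕ → Fin K → Ω → ℝ} {μ : Fin K → ℝ} {ℱ : Filtration ℕ m0}

/-- Rewards are indexed by time rather than by play, so an empirical mean is an adaptively sampled
average. For each arm, each possible count `n ≤ u` and each sign, the supermartingale tilted for
that count gives probability `u^{-4}`; there are `2u` pairs of count and sign. Keeping the event `a
∈ S` inside each term makes the sum over arms an expected memory size, hence a factor `M` instead of
`K`. -/
theorem measureReal_not_accurate_le
    (hsub : ∀ v a, HasSubgaussianMGF (fun ω => Y v a ω - μ a) (1 / 4) P)
    (hind : ∀ v a, Indep (ℱ v) (MeasurableSpace.comap (Y v a) inferInstance) P)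
    (hY : ∀ v a, Measurable[ℱ (v + 1)] (Y v a)) (hS : Measurable[ℱ 0] S) {u : ℕ} (hu : 1 ≤ u) :
    P.real {ω | ¬ Accurate pick (S ω) (fun v a => Y v a ω) μ u} ≤
      2 / (u : ℝ) ^ 3 * ∑ a, P.real {ω | a ∈ S ω} := by
  have hu0 : (0 : ℝ) < u := by exact_mod_cast hu
  have hlog : 0 ≤ Real.log u := Real.log_natCast_nonneg u
  set A : Fin K → ℕ → Set Ω := fun a v =>
    {ω | ucb1Arm pick (S ω) (fun v c => Y v c ω) v = a} with hAdef
  set E : Fin K → Set Ω := fun a => {ω | a ∈ S ω} with hEdef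
  -- This is the optimal tilt for `n` plays and variance proxy `1/4`: a deviation `√(2 n log u)`
  -- contributes at least `8 log u` to the exponent and the compensator removes `4 log u`.
  set l : ℕ → ℝ → ℝ := fun n e => e * (4 * Real.sqrt (2 * Real.log u / n)) with hl
  set D : Fin K × ℕ × ℝ → Set Ω := fun q => E q.1 ∩ {ω | 4 * Real.log u ≤
    ∑ v ∈ Finset.range u, (A q.1 v).indicator
      (fun ω => l q.2.1 q.2.2 * (Y v q.1 ω - μ q.1) -
        ((1 / 4 : ℝ≥0) : ℝ) * l q.2.1 q.2.2 ^ 2 / 2) ω} with hDdef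
  have hcover : {ω | ¬ Accurate pick (S ω) (fun v a => Y v a ω) μ u} ⊆
      ⋃ q ∈ (Finset.univ ×ˢ Finset.Icc 1 u ×ˢ ({1, -1} : Finset ℝ)), D q := by
    intro ω hω
    have hω' : ¬ Accurate pick (S ω) (fun v a => Y v a ω) μ u := hω
    unfold Accurate at hω'
    push Not at hω'
    obtain ⟨a, haS, hn, hdev⟩ := hω'
    set st := ucb1Stats pick (S ω) (fun v a => Y v a ω) u with hst
    have hnu : st.plays a ≤ u := plays_le _ _ _ _ _
    have hnR : (0 : ℝ) < st.plays a := by exact_mod_cast hn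
    obtain ⟨e, he, habs⟩ : ∃ e ∈ ({1, -1} : Finset ℝ),
        e * (st.gain a - μ a * st.plays a) = |st.gain a - μ a * st.plays a| := by
      rcases abs_cases (st.gain a - μ a * st.plays a) with h | h
      · exact ⟨1, by simp, by rw [h.1, one_mul]⟩
      · exact ⟨-1, by simp, by rw [h.1]; ring⟩
    have he2 : e ^ 2 = 1 := by
      simp only [Finset.mem_insert, Finset.mem_singleton] at he
      rcases he with rfl | rfl <;> norm_num
    refine Set.mem_iUnion₂.2 ⟨(a, st.plays a, e), ?_, haS, ?_⟩
    · exact Finset.mem_product.2 ⟨Finset.mem_univ _, Finset.mem_product.2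
        ⟨Finset.mem_Icc.2 ⟨hn, hnu⟩, he⟩⟩
    · have hsum := gain_add_plays_eq_sum pick (S ω) (fun v a => Y v a ω) u a (l (st.plays a) e)
        (μ a) (((1 / 4 : ℝ≥0) : ℝ) * l (st.plays a) e ^ 2 / 2)
      have heq : ∑ v ∈ Finset.range u, (A a v).indicator
          (fun ω => l (st.plays a) e * (Y v a ω - μ a) -
            ((1 / 4 : ℝ≥0) : ℝ) * l (st.plays a) e ^ 2 / 2) ω =
          ∑ v ∈ Finset.range u, if ucb1Arm pick (S ω) (fun v a => Y v a ω) v = a then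
            l (st.plays a) e * (Y v a ω - μ a) -
              ((1 / 4 : ℝ≥0) : ℝ) * l (st.plays a) e ^ 2 / 2 else 0 := by
        refine Finset.sum_congr rfl fun v _ => ?_
        simp only [Set.indicator_apply, hAdef, Set.mem_ofPred_eq]
      have hgoal : 4 * Real.log u ≤ l (st.plays a) e * (st.gain a - μ a * st.plays a) -
          ((1 / 4 : ℝ≥0) : ℝ) * l (st.plays a) e ^ 2 / 2 * st.plays a := by
        have hq0 : 0 ≤ 2 * Real.log u / (st.plays a : ℝ) := by positivity
        have h1 : l (st.plays a) e * (st.gain a - μ a * st.plays a) =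
            4 * Real.sqrt (2 * Real.log u / st.plays a) *
              |st.gain a - μ a * st.plays a| := by
          rw [← habs]; simp only [hl]; ring
        have h2 : l (st.plays a) e ^ 2 = 16 * (2 * Real.log u / st.plays a) := by
          simp only [hl]
          rw [mul_pow, he2, mul_pow, Real.sq_sqrt hq0]; ring
        have h3 : Real.sqrt (2 * Real.log u / st.plays a) *
            Real.sqrt (2 * Real.log u * st.plays a) = 2 * Real.log u := by
          rw [← Real.sqrt_mul hq0]
          have : 2 * Real.log u / st.plays a * (2 * Real.log u * st.plays a) =
              (2 * Real.log u) ^ 2 := by field_simp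
          rw [this, Real.sqrt_sq (by positivity)]
        have h4 := mul_le_mul_of_nonneg_left hdev.le
          (Real.sqrt_nonneg (2 * Real.log u / (st.plays a : ℝ)))
        have h5 : ((1 / 4 : ℝ≥0) : ℝ) * (16 * (2 * Real.log u / st.plays a)) / 2 * st.plays a =
            4 * Real.log u := by
          push_cast
          field_simp
          norm_num
        rw [h1, h2, h5]
        nlinarith
      show 4 * Real.log u ≤ _
      rw [heq, ← hsum]
      exact hgoal
  have hAm : ∀ a v, MeasurableSet[ℱ v] (A a v) := by
    intro a v
    have h := @measurable_ucb1Arm Ω (ℱ v) K pick S (hS.mono (ℱ.mono (Nat.zero_le v)) le_rfl) Y v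
      (fun w hw c => (hY w c).mono (ℱ.mono hw) le_rfl)
    exact h (measurableSet_singleton a)
  have hDle : ∀ q, P.real (D q) ≤ 1 / (u : ℝ) ^ 4 * P.real (E q.1) := by
    intro q
    have h := measureReal_adaptive_ge_le (P := P) ℱ (c := 1 / 4) (hsub · q.1)
      (fun v => indep_of_indep_of_le_right (hind v q.1) ?_)
      (fun v => (hY v q.1).sub_const _) (hAm q.1)
      (E := E q.1) ?_ (l q.2.1 q.2.2) (4 * Real.log u) u
    · refine h.trans (le_of_eq ?_)
      have hexp : Real.exp (-(4 * Real.log u)) = 1 / (u : ℝ) ^ 4 := by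
        rw [Real.exp_neg, ← Real.exp_log (by positivity : 0 < (u : ℝ) ^ 4), Real.log_pow]
        simp
      rw [hexp]
    · have : Measurable[MeasurableSpace.comap (Y v q.1) inferInstance]
          (fun ω => Y v q.1 ω - μ q.1) :=
        (comap_measurable (Y v q.1)).sub_const _
      exact this.comap_le
    · exact hS (measurableSet_mem_finset q.1)
  calc _ ≤ P.real (⋃ q ∈ (Finset.univ ×ˢ Finset.Icc 1 u ×ˢ ({1, -1} : Finset ℝ)), D q) :=
        measureReal_mono hcover (measure_ne_top P _)
    _ ≤ ∑ q ∈ (Finset.univ ×ˢ Finset.Icc 1 u ×ˢ ({1, -1} : Finset ℝ)), P.real (D q) :=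
        measureReal_biUnion_finset_le _ _
    _ ≤ ∑ q ∈ (Finset.univ ×ˢ Finset.Icc 1 u ×ˢ ({1, -1} : Finset ℝ)),
          1 / (u : ℝ) ^ 4 * P.real (E q.1) := Finset.sum_le_sum fun q _ => hDle q
    _ = 2 / (u : ℝ) ^ 3 * ∑ a, P.real (E a) := by
        rw [Finset.sum_product]
        simp only [Finset.sum_const, Finset.card_product, Nat.card_Icc, Nat.add_sub_cancel]
        rw [Finset.card_pair (by norm_num), Finset.mul_sum]
        refine Finset.sum_congr rfl fun a _ => ?_
        rw [nsmul_eq_mul]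
        push_cast
        field_simp

/-- The sum is the expectation of the cardinality of `S`. -/
theorem sum_measureReal_mem_le (hS : Measurable S) {M : ℕ} (hM : ∀ ω, (S ω).card ≤ M) :
    ∑ a, P.real {ω | a ∈ S ω} ≤ M := by
  have hm : ∀ a, MeasurableSet {ω | a ∈ S ω} := fun a =>
    measurableSet_setOfPred.2 (measurable_finset_iff.1 hS a)
  have h1 : ∀ a, P.real {ω | a ∈ S ω} = ∫ ω, {ω | a ∈ S ω}.indicator (fun _ => (1 : ℝ)) ω ∂P := by
    intro a
    rw [integral_indicator (hm a)]
    simp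
  simp only [h1]
  rw [← integral_finsetSum _ fun a _ => (integrable_const (1 : ℝ)).indicator (hm a)]
  calc _ ≤ ∫ _, (M : ℝ) ∂P := by
        refine integral_mono (integrable_finsetSum _ fun a _ =>
          (integrable_const (1 : ℝ)).indicator (hm a)) (integrable_const _) fun ω => ?_
        have : ∑ a, {ω | a ∈ S ω}.indicator (fun _ => (1 : ℝ)) ω = (S ω).card := by
          simp [Set.indicator_apply]
        rw [this]
        exact Nat.cast_le.2 (hM ω)
    _ = M := by simp

/-- Summing `2 M / u^3` over `u ≥ √b` gives order `M / b`, small enough that a failure costs only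
order `M` in a run of length `b`. Starting the sum at `√b` is what makes this possible. -/
theorem measureReal_not_forall_accurate_le
    (hsub : ∀ v a, HasSubgaussianMGF (fun ω => Y v a ω - μ a) (1 / 4) P)
    (hind : ∀ v a, Indep (ℱ v) (MeasurableSpace.comap (Y v a) inferInstance) P)
    (hY : ∀ v a, Measurable[ℱ (v + 1)] (Y v a)) (hS : Measurable[ℱ 0] S)
    {M : ℕ} (hM : ∀ ω, (S ω).card ≤ M) {b : ℕ} (hb : 4 ≤ b) :
    P.real {ω | ¬ ∀ u < b, b ≤ u * u → Accurate pick (S ω) (fun v a => Y v a ω) μ u} ≤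
      18 * M / b := by
  have hcover : {ω | ¬ ∀ u < b, b ≤ u * u → Accurate pick (S ω) (fun v a => Y v a ω) μ u} ⊆
      ⋃ u ∈ (Finset.range b).filter (fun u => b ≤ u * u),
        {ω | ¬ Accurate pick (S ω) (fun v a => Y v a ω) μ u} := by
    intro ω hω
    have hω' : ¬ ∀ u < b, b ≤ u * u → Accurate pick (S ω) (fun v a => Y v a ω) μ u := hω
    push Not at hω'
    obtain ⟨u, hu, hbu, hacc⟩ := hω'
    exact Set.mem_iUnion₂.2 ⟨u, Finset.mem_filter.2 ⟨Finset.mem_range.2 hu, hbu⟩, hacc⟩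
  have hsum := sum_measureReal_mem_le (P := P) (hS.mono (ℱ.le 0) le_rfl) hM
  calc _ ≤ P.real (⋃ u ∈ (Finset.range b).filter (fun u => b ≤ u * u),
        {ω | ¬ Accurate pick (S ω) (fun v a => Y v a ω) μ u}) := measureReal_mono hcover (measure_ne_top P _)
    _ ≤ ∑ u ∈ (Finset.range b).filter (fun u => b ≤ u * u),
        P.real {ω | ¬ Accurate pick (S ω) (fun v a => Y v a ω) μ u} :=
        measureReal_biUnion_finset_le _ _
    _ ≤ ∑ u ∈ (Finset.range b).filter (fun u => b ≤ u * u), 2 * M * (1 / (u : ℝ) ^ 3) := by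
        refine Finset.sum_le_sum fun u hu => ?_
        have hu1 : 1 ≤ u := by
          have := (Finset.mem_filter.1 hu).2
          rcases Nat.eq_zero_or_pos u with rfl | h
          · omega
          · exact h
        refine (measureReal_not_accurate_le hsub hind hY hS hu1).trans ?_
        calc 2 / (u : ℝ) ^ 3 * ∑ a, P.real {ω | a ∈ S ω} ≤ 2 / (u : ℝ) ^ 3 * M := by gcongr
          _ = _ := by ring
    _ = 2 * M * ∑ u ∈ (Finset.range b).filter (fun u => b ≤ u * u), 1 / (u : ℝ) ^ 3 :=
        (Finset.mul_sum _ _ _).symm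
    _ ≤ 2 * M * (9 / b) := by
        gcongr
        exact sum_filter_one_div_cube_le hb
    _ = 18 * M / b := by ring

end ExpectedRun

/-! ### Every arm enters the arm memory in every phase -/

section Coverage

variable {K : ℕ}

theorem injOn_rank (U : Finset (Fin K)) :
    Set.InjOn (fun a => (U.filter (fun c => c < a)).card) (U : Set (Fin K)) := by
  have hlt : ∀ a ∈ U, ∀ d, a < d →
      (U.filter (fun c => c < a)).card < (U.filter (fun c => c < d)).card := by
    intro a ha d had
    refine Finset.card_lt_card (Finset.ssubset_iff_of_subset ?_ |>.2 ⟨a, ?_, ?_⟩)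
    · intro c hc
      exact Finset.mem_filter.2 ⟨(Finset.mem_filter.1 hc).1, (Finset.mem_filter.1 hc).2.trans had⟩
    · exact Finset.mem_filter.2 ⟨ha, had⟩
    · simp
  intro a ha d hd had
  rcases lt_trichotomy a d with h | h | h
  · exact absurd had (hlt a ha d h).ne
  · exact h
  · exact absurd had (hlt d hd a h).ne'

/-- The rank, the number of smaller elements, maps `U` bijectively onto an initial segment of `ℕ`.
-/
theorem card_lowest (m : ℕ) (U : Finset (Fin K)) : (lowest m U).card = min m U.card := by
  set rank : Fin K → ℕ := fun a => (U.filter (fun c => c < a)).card with hrank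
  have hinj : Set.InjOn rank (U : Set (Fin K)) := injOn_rank U
  have himg : U.image rank = Finset.range U.card := by
    refine Finset.eq_of_subset_of_card_le ?_ ?_
    · intro n hn
      obtain ⟨a, ha, rfl⟩ := Finset.mem_image.1 hn
      refine Finset.mem_range.2 (Finset.card_lt_card (Finset.ssubset_iff_of_subset
        (Finset.filter_subset _ _) |>.2 ⟨a, ha, by simp⟩))
    · rw [Finset.card_range, Finset.card_image_of_injOn hinj]
  have hlow : (lowest m U).image rank = Finset.range (min m U.card) := by
    ext n
    simp only [Finset.mem_image, Finset.mem_range, lt_min_iff]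
    constructor
    · rintro ⟨a, ha, rfl⟩
      obtain ⟨h1, h2⟩ := Finset.mem_filter.1 ha
      exact ⟨h2, Finset.mem_range.1 (himg ▸ Finset.mem_image_of_mem rank h1)⟩
    · rintro ⟨h1, h2⟩
      obtain ⟨a, ha, rfl⟩ := Finset.mem_image.1 (himg.symm ▸ Finset.mem_range.2 h2)
      exact ⟨a, Finset.mem_filter.2 ⟨ha, h1⟩, rfl⟩
  rw [← Finset.card_image_of_injOn (hinj.mono
    (Finset.coe_subset.2 (Finset.filter_subset _ _) : (lowest m U : Set (Fin K)) ⊆ U)), hlow,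
    Finset.card_range]

theorem lowest_subset (m : ℕ) (U : Finset (Fin K)) : lowest m U ⊆ U := Finset.filter_subset _ _

theorem memory_nonempty (M : ℕ) (st : SubState K) : (memory M st).Nonempty :=
  Finset.insert_nonempty _ _

theorem card_memory_le {M : ℕ} (hM : 1 ≤ M) (st : SubState K) : (memory M st).card ≤ M := by
  unfold memory
  refine (Finset.card_insert_le _ _).trans ?_
  rw [card_lowest]
  omega

/-- The forwarded arm occupies one slot and the other `M - 1` go to new arms while any are left. The
`max 1` accounts for the first sub-phase of a phase, where the forwarded arm itself is new. -/
theorem le_card_used_union_memory (M : ℕ) (st : SubState K) :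
    min K (max 1 st.used.card + (M - 1)) ≤ (st.used ∪ memory M st).card := by
  have hdisj : Disjoint (insert st.forwarded st.used)
      (lowest (M - 1) (Finset.univ \ insert st.forwarded st.used)) :=
    (Finset.sdiff_disjoint.mono_left (lowest_subset _ _)).symm
  have heq : st.used ∪ memory M st = insert st.forwarded st.used ∪
      lowest (M - 1) (Finset.univ \ insert st.forwarded st.used) := by
    unfold memory
    ext a
    simp only [Finset.mem_union, Finset.mem_insert]
    tauto
  rw [heq, Finset.card_union_of_disjoint hdisj, card_lowest,
    Finset.card_sdiff_of_subset (Finset.subset_univ _), Finset.card_univ, Fintype.card_fin]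
  have h1 : st.used.card ≤ (insert st.forwarded st.used).card :=
    Finset.card_le_card (Finset.subset_insert _ _)
  have h2 : 1 ≤ (insert st.forwarded st.used).card := Finset.card_pos.2 (Finset.insert_nonempty _ _)
  have h3 : (insert st.forwarded st.used).card ≤ K := card_finset_fin_le _
  omega

theorem numSub_pos {M : ℕ} (hK : 2 ≤ K) (hM : 2 ≤ M) : 0 < numSub K M := by
  unfold numSub
  rw [Nat.ceilDiv_eq_add_pred_div]
  exact Nat.div_pos (by omega) (by omega)

theorem le_numSub_mul {M : ℕ} (hM : 2 ≤ M) : K - 1 ≤ numSub K M * (M - 1) := by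
  unfold numSub
  have h := (ceilDiv_le_iff_le_mul (a := M - 1) (b := K - 1) (c := (K - 1) ⌈/⌉ (M - 1))
    (by omega)).1 le_rfl
  rwa [mul_comm] at h

variable [NeZero K] (tie : TieRule K) (M : ℕ) (Y : ℕ → Fin K → ℝ)

theorem forwarded_succ_mem_mostPlayed (s : ℕ) :
    (subState tie M Y (s + 1)).forwarded ∈ mostPlayed (memory M (subState tie M Y s))
      (ucb1Stats (fun u => tie.pull (subStart K M s + u)) (memory M (subState tie M Y s))
        (fun u => Y (subStart K M s + u)) (subBudget K M s)) := by
  simp only [subState]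
  refine tie.recommend_mem _ _ ?_
  obtain ⟨a, ha, hmax⟩ := (memory M (subState tie M Y s)).exists_max_image
    (ucb1Stats (fun u => tie.pull (subStart K M s + u)) (memory M (subState tie M Y s))
      (fun u => Y (subStart K M s + u)) (subBudget K M s)).plays (memory_nonempty _ _)
  exact ⟨a, Finset.mem_filter.2 ⟨ha, hmax⟩⟩

theorem forwarded_succ_mem (s : ℕ) :
    (subState tie M Y (s + 1)).forwarded ∈ memory M (subState tie M Y s) :=
  Finset.filter_subset _ _ (forwarded_succ_mem_mostPlayed tie M Y s)

theorem forwarded_mem_memory (s : ℕ) :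
    (subState tie M Y s).forwarded ∈ memory M (subState tie M Y s) :=
  Finset.mem_insert_self _ _

/-- The count and the membership claim are proved together: the first shows that the phase exhausts
all arms, the second locates each of them in an actual memory of the phase. -/
theorem used_union_memory (w j : ℕ) (hj : j < numSub K M) :
    min K (1 + (j + 1) * (M - 1)) ≤
      ((subState tie M Y (w * numSub K M + j)).used ∪
        memory M (subState tie M Y (w * numSub K M + j))).card ∧
    ∀ a ∈ (subState tie M Y (w * numSub K M + j)).used ∪
        memory M (subState tie M Y (w * numSub K M + j)),
      ∃ i ≤ j, a ∈ memory M (subState tie M Y (w * numSub K M + i)) := by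
  induction j with
  | zero =>
    have hused : (subState tie M Y (w * numSub K M + 0)).used = ∅ := by
      rcases Nat.eq_zero_or_pos (w * numSub K M) with h | h
      · simp [h, subState]
      · obtain ⟨n, hn⟩ : ∃ n, w * numSub K M = n + 1 := ⟨w * numSub K M - 1, by omega⟩
        rw [add_zero, hn]
        simp only [subState]
        rw [← hn, if_pos (Nat.mul_mod_left _ _)]
    constructor
    · refine le_trans ?_ (le_card_used_union_memory M _)
      rw [hused, Finset.card_empty]
      omega
    · intro a ha
      rw [hused, Finset.empty_union] at ha
      exact ⟨0, le_rfl, ha⟩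
  | succ j ih =>
    obtain ⟨h1, h2⟩ := ih (by omega)
    have hused : (subState tie M Y (w * numSub K M + (j + 1))).used =
        (subState tie M Y (w * numSub K M + j)).used ∪
        memory M (subState tie M Y (w * numSub K M + j)) := by
      rw [← add_assoc]
      simp only [subState]
      rw [if_neg]
      rw [add_assoc, Nat.mul_add_mod_self_right, Nat.mod_eq_of_lt hj]
      omega
    constructor
    · refine le_trans ?_ (le_card_used_union_memory M _)
      rw [hused]
      have : (j + 1 + 1) * (M - 1) = (j + 1) * (M - 1) + (M - 1) := by ring
      omega
    · intro a ha
      rw [hused] at ha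
      rcases Finset.mem_union.1 ha with ha | ha
      · obtain ⟨i, hi, hai⟩ := h2 a ha
        exact ⟨i, by omega, hai⟩
      · exact ⟨j + 1, le_rfl, ha⟩

theorem exists_mem_memory {M : ℕ} (hK : 2 ≤ K) (hM : 2 ≤ M) (w : ℕ) (a : Fin K) :
    ∃ i < numSub K M, a ∈ memory M (subState tie M Y (w * numSub K M + i)) := by
  have hpos := numSub_pos hK hM
  obtain ⟨h1, h2⟩ := used_union_memory tie M Y w (numSub K M - 1) (by omega)
  have hle := le_numSub_mul (K := K) hM
  rw [Nat.sub_add_cancel hpos] at h1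
  have hcard : (Finset.univ : Finset (Fin K)).card ≤
      ((subState tie M Y (w * numSub K M + (numSub K M - 1))).used ∪
        memory M (subState tie M Y (w * numSub K M + (numSub K M - 1)))).card := by
    rw [Finset.card_univ, Fintype.card_fin]
    omega
  have huniv := Finset.eq_of_subset_of_card_le (Finset.subset_univ _) hcard
  obtain ⟨i, hi, hai⟩ := h2 a (huniv ▸ Finset.mem_univ a)
  exact ⟨i, by omega, hai⟩

end Coverage

/-! ### The best arm in memory -/

section BestMean

variable {K : ℕ}

/-- The largest mean among the arms of `S`. -/
noncomputable def bestMean (μ : Fin K → ℝ) (S : Finset (Fin K)) : ℝ :=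
  if h : S.Nonempty then S.sup' h μ else 0

theorem le_bestMean (μ : Fin K → ℝ) {S : Finset (Fin K)} {a : Fin K} (ha : a ∈ S) :
    μ a ≤ bestMean μ S := by
  unfold bestMean
  rw [dif_pos ⟨a, ha⟩]
  exact Finset.le_sup' μ ha

theorem exists_bestMean_eq (μ : Fin K → ℝ) {S : Finset (Fin K)} (hS : S.Nonempty) :
    ∃ c ∈ S, bestMean μ S = μ c := by
  unfold bestMean
  rw [dif_pos hS]
  exact Finset.exists_mem_eq_sup' hS μ

theorem bestMean_nonneg {μ : Fin K → ℝ} (hμ : ∀ a, 0 ≤ μ a) (S : Finset (Fin K)) :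
    0 ≤ bestMean μ S := by
  by_cases h : S.Nonempty
  · obtain ⟨c, -, hc⟩ := exists_bestMean_eq μ h
    exact hc ▸ hμ c
  · simp [bestMean, h]

theorem bestMean_le_one {μ : Fin K → ℝ} (hμ : ∀ a, μ a ≤ 1) (S : Finset (Fin K)) :
    bestMean μ S ≤ 1 := by
  by_cases h : S.Nonempty
  · obtain ⟨c, -, hc⟩ := exists_bestMean_eq μ h
    exact hc ▸ hμ c
  · simp [bestMean, h]

variable [NeZero K] (tie : TieRule K) (M : ℕ) (Y : ℕ → Fin K → ℝ) (μ : Fin K → ℝ)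

/-- The simple regret of sub-phase `s`: how much worse the forwarded arm is than the best arm in
memory. -/
noncomputable def simpleRegret (s : ℕ) : ℝ :=
  bestMean μ (memory M (subState tie M Y s)) - μ (subState tie M Y (s + 1)).forwarded

theorem simpleRegret_nonneg (s : ℕ) : 0 ≤ simpleRegret tie M Y μ s :=
  sub_nonneg.2 (le_bestMean μ (forwarded_succ_mem tie M Y s))

/-- The forwarded arm belongs to the next memory, across phase boundaries too, so the best mean in
memory drops by at most the simple regret at each sub-phase. -/
theorem bestMean_le_add_sum_simpleRegret {s r : ℕ} (h : s ≤ r) :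
    bestMean μ (memory M (subState tie M Y s)) ≤ bestMean μ (memory M (subState tie M Y r)) +
      ∑ i ∈ Finset.Ico s r, simpleRegret tie M Y μ i := by
  induction r, h using Nat.le_induction with
  | base => simp
  | succ r h ih =>
    rw [Finset.sum_Ico_succ_top h]
    have := le_bestMean μ (forwarded_mem_memory tie M Y (r + 1))
    have hr : simpleRegret tie M Y μ r = bestMean μ (memory M (subState tie M Y r)) -
      μ (subState tie M Y (r + 1)).forwarded := rfl
    linarith

/-- From the second phase on, the loss in the best arm in memory is at most the total simple regret
of the current and the previous phase. -/
theorem mean_sub_bestMean_le {M : ℕ} (hK : 2 ≤ K) (hM : 2 ≤ M) (c : Fin K) {s w : ℕ}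
    (hs : (w + 1) * numSub K M ≤ s) :
    μ c - bestMean μ (memory M (subState tie M Y s)) ≤
      ∑ i ∈ Finset.Ico (w * numSub K M) s, simpleRegret tie M Y μ i := by
  obtain ⟨i, hi, hmem⟩ := exists_mem_memory tie Y hK hM w c
  have hle : w * numSub K M + i ≤ s := by
    have : (w + 1) * numSub K M = w * numSub K M + numSub K M := by ring
    omega
  have h1 := bestMean_le_add_sum_simpleRegret tie M Y μ hle
  have h2 := le_bestMean μ hmem
  have h3 : ∑ j ∈ Finset.Ico (w * numSub K M + i) s, simpleRegret tie M Y μ j ≤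
      ∑ j ∈ Finset.Ico (w * numSub K M) s, simpleRegret tie M Y μ j :=
    Finset.sum_le_sum_of_subset_of_nonneg (Finset.Ico_subset_Ico_left (by omega))
      fun j _ _ => simpleRegret_nonneg tie M Y μ j
  linarith

end BestMean

/-! ### Expected regret and simple regret of a sub-phase -/

section ExpectedSubphase

variable {Ω : Type*} {m0 : MeasurableSpace Ω} {P : Measure Ω} [IsProbabilityMeasure P] {K : ℕ}

theorem integrable_comp_arm {g : Ω → Fin K} (hg : Measurable g) (μ : Fin K → ℝ)
    (hμ : ∀ a, 0 ≤ μ a) (hμ' : ∀ a, μ a ≤ 1) : Integrable (fun ω => μ (g ω)) P :=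
  Integrable.of_mem_Icc 0 1 ((Measurable.of_discrete (f := μ)).comp hg).aemeasurable
    (Filter.Eventually.of_forall fun _ => ⟨hμ _, hμ' _⟩)

theorem integrable_bestMean {S : Ω → Finset (Fin K)} (hS : Measurable S) {μ : Fin K → ℝ}
    (hμ : ∀ a, 0 ≤ μ a) (hμ' : ∀ a, μ a ≤ 1) : Integrable (fun ω => bestMean μ (S ω)) P :=
  Integrable.of_mem_Icc 0 1 ((Measurable.of_discrete (f := bestMean μ)).comp hS).aemeasurable
    (Filter.Eventually.of_forall fun _ => ⟨bestMean_nonneg hμ _, bestMean_le_one hμ' _⟩)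

theorem one_le_log_natCast {b : ℕ} (hb : 3 ≤ b) : 1 ≤ Real.log b := by
  have hbR : (3 : ℝ) ≤ b := by exact_mod_cast hb
  rw [Real.le_log_iff_exp_le (by linarith)]
  exact (Real.exp_one_lt_d9.le).trans (by linarith)

section Run

variable {pick : ℕ → Finset (Fin K) → Fin K} {S : Ω → Finset (Fin K)}
  {Y : ℕ → Fin K → Ω → ℝ} {μ : Fin K → ℝ} {ℱ : Filtration ℕ m0}

/-- The accurate event contributes 14 times the root. The complement contributes at most `b * (18 M
/ b) = 18 M`, which is at most 18 times the root because `M * M ≤ b`. -/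
theorem integral_sum_gap_le (hpick : ∀ n s, s.Nonempty → pick n s ∈ s)
    (hsub : ∀ v a, HasSubgaussianMGF (fun ω => Y v a ω - μ a) (1 / 4) P)
    (hind : ∀ v a, Indep (ℱ v) (MeasurableSpace.comap (Y v a) inferInstance) P)
    (hY : ∀ v a, Measurable[ℱ (v + 1)] (Y v a)) (hS : Measurable[ℱ 0] S)
    (hne : ∀ ω, (S ω).Nonempty) {M : ℕ} (hM : ∀ ω, (S ω).card ≤ M)
    (hμ : ∀ a, 0 ≤ μ a) (hμ' : ∀ a, μ a ≤ 1) {b : ℕ} (hb : M * M ≤ b) (hb4 : 4 ≤ b) {t : ℕ}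
    (ht : t ≤ b) :
    ∫ ω, ∑ v ∈ Finset.range t,
        (bestMean μ (S ω) - μ (ucb1Arm pick (S ω) (fun v a => Y v a ω) v)) ∂P ≤
      32 * Real.sqrt (M * b * Real.log b) := by
  have hSm : Measurable S := hS.mono (ℱ.le 0) le_rfl
  have hint : Integrable (fun ω => ∑ v ∈ Finset.range t,
      (bestMean μ (S ω) - μ (ucb1Arm pick (S ω) (fun v a => Y v a ω) v))) P :=
    integrable_finsetSum _ fun v _ => (integrable_bestMean hSm hμ hμ').sub
      (integrable_comp_arm (measurable_ucb1Arm hSm v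
        fun w _ a => (hY w a).mono (ℱ.le _) le_rfl) μ hμ hμ')
  have hgood := integral_le_add_measureReal (P := P) hint
    (N := {ω | ¬ ∀ u < b, b ≤ u * u → Accurate pick (S ω) (fun v a => Y v a ω) μ u})
    (B := 14 * Real.sqrt (M * b * Real.log b)) (D := b) (by positivity) ?_ ?_
  · have hbad := measureReal_not_forall_accurate_le (pick := pick) hsub hind hY hS hM hb4
    have hb0 : (0 : ℝ) < b := by exact_mod_cast (by omega : 0 < b)
    have h1 : (b : ℝ) * P.real {ω | ¬ ∀ u < b, b ≤ u * u →
        Accurate pick (S ω) (fun v a => Y v a ω) μ u} ≤ 18 * M := by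
      calc _ ≤ (b : ℝ) * (18 * M / b) := by gcongr
        _ = 18 * M := by field_simp
    have h2 : (M : ℝ) ≤ Real.sqrt (M * b * Real.log b) := by
      refine Real.le_sqrt_of_sq_le ?_
      have hlog := one_le_log_natCast (by omega : 3 ≤ b)
      have hMb : (M : ℝ) * M ≤ b := by exact_mod_cast hb
      rcases Nat.eq_zero_or_pos M with rfl | hM0
      · simp
      · have hM1 : (1 : ℝ) ≤ M := by exact_mod_cast hM0
        calc (M : ℝ) ^ 2 = 1 * (M * M) * 1 := by ring
          _ ≤ M * b * Real.log b := by gcongr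
    linarith
  · intro ω hω
    have hacc : ∀ u < b, b ≤ u * u → Accurate pick (S ω) (fun v a => Y v a ω) μ u :=
      not_not.1 hω
    obtain ⟨c, hc, hceq⟩ := exists_bestMean_eq μ (hne ω)
    rw [hceq]
    exact sum_gap_le hpick hμ hμ' (hM ω) hb (by omega) hacc hc ht
  · intro ω
    calc _ ≤ ∑ v ∈ Finset.range t, (1 : ℝ) := by
          refine Finset.sum_le_sum fun v _ => ?_
          have := bestMean_le_one hμ' (S ω)
          have := hμ (ucb1Arm pick (S ω) (fun v a => Y v a ω) v)
          linarith
      _ ≤ b := by simpa using ht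

theorem integral_gap_mostPlayed_le (hpick : ∀ n s, s.Nonempty → pick n s ∈ s)
    (hsub : ∀ v a, HasSubgaussianMGF (fun ω => Y v a ω - μ a) (1 / 4) P)
    (hind : ∀ v a, Indep (ℱ v) (MeasurableSpace.comap (Y v a) inferInstance) P)
    (hY : ∀ v a, Measurable[ℱ (v + 1)] (Y v a)) (hS : Measurable[ℱ 0] S)
    (hne : ∀ ω, (S ω).Nonempty) {M : ℕ} (hM : ∀ ω, (S ω).card ≤ M)
    (hμ : ∀ a, 0 ≤ μ a) (hμ' : ∀ a, μ a ≤ 1) {b x : ℕ} (hx : M + 2 ≤ x) (hb : b = M * x)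
    (hb4 : 4 ≤ b) {g : Ω → Fin K} (hg : Measurable g)
    (hgm : ∀ ω, g ω ∈ mostPlayed (S ω) (ucb1Stats pick (S ω) (fun v a => Y v a ω) b)) :
    ∫ ω, (bestMean μ (S ω) - μ (g ω)) ∂P ≤ 22 * Real.sqrt (M * Real.log b / b) := by
  have hSm : Measurable S := hS.mono (ℱ.le 0) le_rfl
  have hgood := integral_le_add_measureReal (P := P)
    ((integrable_bestMean hSm hμ hμ').sub (integrable_comp_arm hg μ hμ hμ'))
    (N := {ω | ¬ ∀ u < b, b ≤ u * u → Accurate pick (S ω) (fun v a => Y v a ω) μ u})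
    (B := 4 * Real.sqrt (M * Real.log b / b)) (D := 1) (by positivity) ?_ ?_
  · have hbad := measureReal_not_forall_accurate_le (pick := pick) hsub hind hY hS hM hb4
    have hb0 : (0 : ℝ) < b := by exact_mod_cast (by omega : 0 < b)
    have h2 : (M : ℝ) / b ≤ Real.sqrt (M * Real.log b / b) := by
      refine Real.le_sqrt_of_sq_le ?_
      have hlog := one_le_log_natCast (by omega : 3 ≤ b)
      have hMb : (M : ℝ) ≤ b := by
        have : M * 1 ≤ M * x := Nat.mul_le_mul_left _ (by omega)
        exact_mod_cast (by omega : M ≤ b)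
      calc ((M : ℝ) / b) ^ 2 = M * (M / b) / b := by ring
        _ ≤ M * Real.log b / b := by
            gcongr
            exact ((div_le_one hb0).2 hMb).trans hlog
    simp only [one_mul, Pi.sub_apply] at hgood
    have h3 : 18 * (M : ℝ) / b = 18 * (M / b) := by ring
    linarith
  · intro ω hω
    have hacc : ∀ u < b, b ≤ u * u → Accurate pick (S ω) (fun v a => Y v a ω) μ u :=
      not_not.1 hω
    obtain ⟨c, hc, hceq⟩ := exists_bestMean_eq μ (hne ω)
    simp only [Pi.sub_apply]
    rw [hceq]
    exact gap_mostPlayed_le hpick (hM ω) hx hb hacc hc (hgm ω)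
  · intro ω
    simp only [Pi.sub_apply]
    have := bestMean_le_one hμ' (S ω)
    have := hμ (g ω)
    linarith

end Run

end ExpectedSubphase

/-! ### Reward tables -/

section RewardTable

variable {Ω : Type*} {m0 : MeasurableSpace Ω} {P : Measure Ω} {K : ℕ}

/-- The rewards at times before `t₀ + v`, as a filtration in `v`. -/
def pastFiltration (X : ℕ → Fin K → Ω → ℝ) (hX : ∀ t a, Measurable (X t a)) (t₀ : ℕ) :
    Filtration ℕ m0 where
  seq v := ⨆ p ∈ {p : ℕ × Fin K | p.1 < t₀ + v},
    MeasurableSpace.comap (X p.1 p.2) inferInstance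
  mono' v w hvw := by
    refine biSup_mono fun p hp => ?_
    have hp' : p.1 < t₀ + v := hp
    show p.1 < t₀ + w
    omega
  le' v := iSup₂_le fun p _ => (hX p.1 p.2).comap_le

variable {ν : Fin K → Measure ℝ} {X : ℕ → Fin K → Ω → ℝ}

theorem measurable_pastFiltration (hX : ∀ t a, Measurable (X t a)) {t₀ v t : ℕ} (ht : t < t₀ + v)
    (a : Fin K) : Measurable[pastFiltration X hX t₀ v] (X t a) := by
  refine measurable_iff_comap_le.2 ?_
  exact le_iSup₂_of_le (f := fun (p : ℕ × Fin K) (_ : p ∈ {p : ℕ × Fin K | p.1 < t₀ + v}) =>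
    MeasurableSpace.comap (X p.1 p.2) inferInstance) (t, a) ht le_rfl

/-- The past and the current reward are generated by disjoint sets of entries of an independent
family. -/
theorem indep_pastFiltration (h : IsRewardTable P ν X) (t₀ v : ℕ) (a : Fin K) :
    Indep (pastFiltration X h.measurable t₀ v)
      (MeasurableSpace.comap (X (t₀ + v) a) inferInstance) P := by
  have hdisj : Disjoint {p : ℕ × Fin K | p.1 < t₀ + v} {(t₀ + v, a)} := by
    rw [Set.disjoint_singleton_right]
    exact fun h => lt_irrefl (t₀ + v) h
  have := indep_iSup_of_disjoint (m := fun p : ℕ × Fin K =>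
    MeasurableSpace.comap (X p.1 p.2) inferInstance)
    (fun p => (h.measurable p.1 p.2).comap_le) h.indep hdisj
  rw [iSup_singleton] at this
  exact this

theorem IsRewardTable.comp_perm (h : IsRewardTable P ν X)
    (σ : Equiv.Perm (Fin K)) :
    IsRewardTable P (fun i => ν (σ i)) (fun t i => X t (σ i)) where
  measurable t i := h.measurable t (σ i)
  law t i := h.law t (σ i)
  indep := h.indep.precomp (g := fun p : ℕ × Fin K => (p.1, σ p.2)) fun p q hpq => by
    simp only [Prod.mk.injEq, EmbeddingLike.apply_eq_iff_eq] at hpq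
    exact Prod.ext hpq.1 hpq.2

/-- Hoeffding's lemma for the unit interval. -/
theorem hasSubgaussianMGF_reward [IsProbabilityMeasure P] (h : IsRewardTable P ν X)
    (hν : ∀ a, ν a (Set.Icc 0 1) = 1) (t : ℕ) (a : Fin K) :
    HasSubgaussianMGF (fun ω => X t a ω - armMean ν a) (1 / 4) P := by
  have hmean : P[X t a] = armMean ν a := by
    unfold armMean
    rw [← h.law t a, integral_map (h.measurable t a).aemeasurable (by fun_prop)]
  have hmem : ∀ᵐ ω ∂P, X t a ω ∈ Set.Icc (0 : ℝ) 1 := by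
    have h1 : P (X t a ⁻¹' Set.Icc 0 1) = 1 := by
      rw [← Measure.map_apply (h.measurable t a) measurableSet_Icc, h.law, hν]
    exact (prob_compl_eq_zero_iff ((h.measurable t a) measurableSet_Icc)).2 h1
  have := hasSubgaussianMGF_of_mem_Icc (h.measurable t a).aemeasurable hmem
  rw [hmean] at this
  convert this using 1
  ext
  norm_num

theorem armMean_mem_Icc (hprob : ∀ a, IsProbabilityMeasure (ν a))
    (hν : ∀ a, ν a (Set.Icc 0 1) = 1) (a : Fin K) : armMean ν a ∈ Set.Icc (0 : ℝ) 1 := by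
  have := hprob a
  have hmem : ∀ᵐ x ∂(ν a), x ∈ Set.Icc (0 : ℝ) 1 :=
    (prob_compl_eq_zero_iff measurableSet_Icc).2 (hν a)
  have hint : Integrable (fun x : ℝ => x) (ν a) :=
    Integrable.of_mem_Icc 0 1 aemeasurable_id hmem
  unfold armMean
  constructor
  · exact integral_nonneg_of_ae (hmem.mono fun x hx => hx.1)
  · calc ∫ x, x ∂(ν a) ≤ ∫ _, (1 : ℝ) ∂(ν a) :=
          integral_mono_ae hint (integrable_const _) (hmem.mono fun x hx => hx.2)
      _ = 1 := by simp

variable [IsProbabilityMeasure P] [NeZero K] (tie : TieRule K)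

theorem subBudget_eq (K M s : ℕ) :
    subBudget K M s = M * ((M + 2) * 2 ^ (s / numSub K M)) := mul_assoc _ _ _

theorem le_subBudget (K M s : ℕ) : M * (M + 2) ≤ subBudget K M s :=
  Nat.le_mul_of_pos_right _ (by positivity)

theorem measurable_memory (hX : ∀ t a, Measurable (X t a)) (M s : ℕ) :
    Measurable fun ω => memory M (subState tie M (fun t c => X t c ω) s) :=
  (measurable_subState tie M s fun t _ a => hX t a).2.2

theorem measurable_memory_past (hX : ∀ t a, Measurable (X t a)) (M s : ℕ) :
    Measurable[pastFiltration X hX (subStart K M s) 0]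
      fun ω => memory M (subState tie M (fun t c => X t c ω) s) :=
  (@measurable_subState Ω (pastFiltration X hX (subStart K M s) 0) K _ tie M X s
    fun _ ht a => measurable_pastFiltration hX ht a).2.2

/-- The expected regret of the first `t` pulls of a sub-phase, relative to the best arm in
memory. -/
theorem integral_subphase_regret_le (h : IsRewardTable P ν X)
    (hprob : ∀ a, IsProbabilityMeasure (ν a)) (hν : ∀ a, ν a (Set.Icc 0 1) = 1) {M : ℕ}
    (hM : 2 ≤ M) (s : ℕ) {t : ℕ} (ht : t ≤ subBudget K M s) :
    ∫ ω, ∑ v ∈ Finset.range t,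
      (bestMean (armMean ν) (memory M (subState tie M (fun t c => X t c ω) s)) -
        armMean ν (ucb1Arm (fun u => tie.pull (subStart K M s + u))
          (memory M (subState tie M (fun t c => X t c ω) s))
          (fun u c => X (subStart K M s + u) c ω) v)) ∂P ≤
      32 * Real.sqrt (M * subBudget K M s * Real.log (subBudget K M s)) := by
  have hb := le_subBudget K M s
  exact integral_sum_gap_le (pick := fun u => tie.pull (subStart K M s + u))
    (Y := fun u => X (subStart K M s + u)) (ℱ := pastFiltration X h.measurable (subStart K M s))
    (fun n => tie.pull_mem _) (fun v a => hasSubgaussianMGF_reward h hν _ a)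
    (fun v a => indep_pastFiltration h _ v a)
    (fun v a => measurable_pastFiltration h.measurable (by omega) a)
    (measurable_memory_past tie h.measurable M s) (fun ω => memory_nonempty _ _)
    (fun ω => card_memory_le (by omega) _) (fun a => (armMean_mem_Icc hprob hν a).1)
    (fun a => (armMean_mem_Icc hprob hν a).2) (by nlinarith) (by nlinarith) ht

theorem integral_simpleRegret_le (h : IsRewardTable P ν X)
    (hprob : ∀ a, IsProbabilityMeasure (ν a)) (hν : ∀ a, ν a (Set.Icc 0 1) = 1) {M : ℕ}
    (hM : 2 ≤ M) (s : ℕ) :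
    ∫ ω, simpleRegret tie M (fun t c => X t c ω) (armMean ν) s ∂P ≤
      22 * Real.sqrt (M * Real.log (subBudget K M s) / subBudget K M s) := by
  have hb := le_subBudget K M s
  exact integral_gap_mostPlayed_le (pick := fun u => tie.pull (subStart K M s + u))
    (Y := fun u => X (subStart K M s + u)) (ℱ := pastFiltration X h.measurable (subStart K M s))
    (fun n => tie.pull_mem _) (fun v a => hasSubgaussianMGF_reward h hν _ a)
    (fun v a => indep_pastFiltration h _ v a)
    (fun v a => measurable_pastFiltration h.measurable (by omega) a)
    (measurable_memory_past tie h.measurable M s) (fun ω => memory_nonempty _ _)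
    (fun ω => card_memory_le (by omega) _) (fun a => (armMean_mem_Icc hprob hν a).1)
    (fun a => (armMean_mem_Icc hprob hν a).2)
    (Nat.le_mul_of_pos_right _ (by positivity)) (subBudget_eq K M s) (by nlinarith)
    (measurable_subState tie M (s + 1) fun t _ a => h.measurable t a).1
    (fun ω => forwarded_succ_mem_mostPlayed tie M _ s)

theorem integrable_simpleRegret (h : IsRewardTable P ν X)
    (hprob : ∀ a, IsProbabilityMeasure (ν a)) (hν : ∀ a, ν a (Set.Icc 0 1) = 1) (M s : ℕ) :
    Integrable (fun ω => simpleRegret tie M (fun t c => X t c ω) (armMean ν) s) P :=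
  (integrable_bestMean (measurable_memory tie h.measurable M s)
    (fun a => (armMean_mem_Icc hprob hν a).1) (fun a => (armMean_mem_Icc hprob hν a).2)).sub
    (integrable_comp_arm (measurable_subState tie M (s + 1) fun t _ a => h.measurable t a).1 _
    (fun a => (armMean_mem_Icc hprob hν a).1) (fun a => (armMean_mem_Icc hprob hν a).2))

end RewardTable

/-! ### The schedule of sub-phases -/

section Schedule

variable {K : ℕ}

theorem subStart_succ (K M s : ℕ) : subStart K M (s + 1) = subStart K M s + subBudget K M s :=
  Finset.sum_range_succ _ _

theorem subBudget_pos {M : ℕ} (hM : 2 ≤ M) (K s : ℕ) : 0 < subBudget K M s :=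
  lt_of_lt_of_le (by positivity) (le_subBudget K M s)

theorem subBudget_mono (K M : ℕ) : Monotone (subBudget K M) := fun _ _ h =>
  Nat.mul_le_mul_left _ (Nat.pow_le_pow_right two_pos (Nat.div_le_div_right h))

theorem subStart_mono (K M : ℕ) : Monotone (subStart K M) :=
  monotone_nat_of_le_succ fun s => (subStart_succ K M s).symm ▸ Nat.le_add_right _ _

/-- Shows that the search bound `t` in `subAt` is never binding. -/
theorem le_subStart {M : ℕ} (hM : 2 ≤ M) (K s : ℕ) : s ≤ subStart K M s := by
  induction s with
  | zero => exact Nat.zero_le _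
  | succ s ih =>
    have := subBudget_pos hM K s
    rw [subStart_succ]
    omega

theorem subAt_eq {M : ℕ} (hM : 2 ≤ M) {s u : ℕ} (hu : u < subBudget K M s) :
    subAt K M (subStart K M s + u) = s := by
  have hs := le_subStart hM K s
  refine Nat.findGreatest_eq_iff.2 ⟨by omega, fun _ => Nat.le_add_right _ _, fun n hn _ => ?_⟩
  have := subStart_mono K M (Nat.succ_le_of_lt hn)
  rw [Nat.succ_eq_add_one, subStart_succ] at this
  omega

theorem exists_eq_subStart_add {M : ℕ} (hM : 2 ≤ M) (K T : ℕ) :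
    ∃ q u, T = subStart K M q + u ∧ u < subBudget K M q := by
  induction T with
  | zero => exact ⟨0, 0, by simp [subStart], subBudget_pos hM K 0⟩
  | succ T ih =>
    obtain ⟨q, u, rfl, hu⟩ := ih
    by_cases h : u + 1 < subBudget K M q
    · exact ⟨q, u + 1, rfl, h⟩
    · exact ⟨q + 1, 0, by rw [subStart_succ]; omega, subBudget_pos hM K _⟩

theorem pulledIndex_eq [NeZero K] (tie : TieRule K) {M : ℕ} (hM : 2 ≤ M) (hMK : M < K)
    (Y : ℕ → Fin K → ℝ) {s u : ℕ} (hu : u < subBudget K M s) :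
    pulledIndex tie M Y (subStart K M s + u) =
      ucb1Arm (fun u => tie.pull (subStart K M s + u)) (memory M (subState tie M Y s))
        (fun u => Y (subStart K M s + u)) u := by
  unfold pulledIndex
  rw [if_neg (by omega)]
  simp only [subAt_eq hM hu, Nat.add_sub_cancel_left]

theorem subBudget_mul_add (M w : ℕ) {i : ℕ} (hi : i < numSub K M) :
    subBudget K M (w * numSub K M + i) = M * (M + 2) * 2 ^ w := by
  unfold subBudget
  rw [mul_comm w, Nat.mul_add_div (by omega), Nat.div_eq_of_lt hi, add_zero]

theorem sum_range_phase (K M w : ℕ) (f : ℕ → ℝ) :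
    ∑ s ∈ Finset.range ((w + 1) * numSub K M), f (subBudget K M s) =
      ∑ s ∈ Finset.range (w * numSub K M), f (subBudget K M s) +
        numSub K M * f ((M * (M + 2) * 2 ^ w : ℕ)) := by
  rw [add_mul, one_mul, Finset.sum_range_add]
  congr 1
  rw [Finset.sum_congr rfl fun i hi => by rw [subBudget_mul_add M w (Finset.mem_range.1 hi)]]
  simp

theorem sum_sqrt_subBudget_le (K M w : ℕ) :
    ∑ s ∈ Finset.range ((w + 1) * numSub K M), Real.sqrt (subBudget K M s) ≤
      4 * numSub K M * Real.sqrt ((M * (M + 2) * 2 ^ w : ℕ)) := by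
  induction w with
  | zero =>
    rw [sum_range_phase K M 0 fun n => Real.sqrt n]
    simp only [zero_mul, Finset.range_zero, Finset.sum_empty, zero_add]
    have : 0 ≤ (numSub K M : ℝ) * Real.sqrt ((M * (M + 2) * 2 ^ 0 : ℕ)) := by positivity
    linarith
  | succ w ih =>
    rw [sum_range_phase K M (w + 1) fun n => Real.sqrt n]
    have hsq : Real.sqrt ((M * (M + 2) * 2 ^ (w + 1) : ℕ)) =
        Real.sqrt ((M * (M + 2) * 2 ^ w : ℕ)) * Real.sqrt 2 := by
      rw [← Real.sqrt_mul (Nat.cast_nonneg _)]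
      congr 1
      push_cast
      ring
    -- The constant 4 survives the induction since `4 + √2 ≤ 4 √2`.
    have h2 : (4 : ℝ) / 3 ≤ Real.sqrt 2 := Real.le_sqrt_of_sq_le (by norm_num)
    have h3 : 0 ≤ (numSub K M : ℝ) * Real.sqrt ((M * (M + 2) * 2 ^ w : ℕ)) := by positivity
    rw [hsq]
    nlinarith [mul_le_mul_of_nonneg_left h2 h3]

/-- Geometric summation of the doubling phase lengths. It turns elapsed time into a bound on the
current budget. -/
theorem numSub_mul_le_subStart (K M w : ℕ) :
    numSub K M * (M * (M + 2) * 2 ^ w) =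
      subStart K M (w * numSub K M) + numSub K M * (M * (M + 2)) := by
  induction w with
  | zero => simp [subStart]
  | succ w ih =>
    have h : subStart K M ((w + 1) * numSub K M) = subStart K M (w * numSub K M) +
        numSub K M * (M * (M + 2) * 2 ^ w) := by
      unfold subStart
      rw [add_mul, one_mul, Finset.sum_range_add]
      congr 1
      rw [Finset.sum_congr rfl fun i hi => subBudget_mul_add M w (Finset.mem_range.1 hi)]
      simp
    rw [h, pow_succ]
    linarith

theorem numSub_mul_le {M : ℕ} (hM : 2 ≤ M) (hMK : M < K) : numSub K M * M ≤ 4 * K := by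
  have h : numSub K M * (M - 1) ≤ K - 1 + (M - 1) - 1 := by
    unfold numSub
    rw [Nat.ceilDiv_eq_add_pred_div]
    exact Nat.div_mul_le_self _ _
  obtain ⟨m, rfl⟩ : ∃ m, M = m + 2 := ⟨M - 2, by omega⟩
  have h1 : m + 2 - 1 = m + 1 := by omega
  rw [h1] at h
  have h2 : numSub K (m + 2) * (m + 2) ≤ 2 * (numSub K (m + 2) * (m + 1)) := by nlinarith
  omega

theorem le_numSub_mul_self {M : ℕ} (hM : 2 ≤ M) (hMK : M < K) : K ≤ numSub K M * M := by
  have h := le_numSub_mul (K := K) hM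
  have hp := numSub_pos (K := K) (by omega) hM
  obtain ⟨m, rfl⟩ : ∃ m, M = m + 1 := ⟨M - 1, by omega⟩
  rw [Nat.add_sub_cancel] at h
  rw [mul_add, mul_one]
  omega

theorem schedule_bound {M T : ℕ} (hM : 2 ≤ M) (hMK : M < K) (hT : K * M ^ 2 * (M + 2) < T)
    {q u : ℕ} (hq : T = subStart K M q + u) :
    numSub K M * (M * (M + 2)) + 480 * (numSub K M : ℝ) ^ 2 *
        Real.sqrt (M * subBudget K M q * Real.log (subBudget K M q)) ≤
      9600 * ((K : ℝ) * (M : ℝ) + (K : ℝ) ^ (3 / 2 : ℝ) / (M : ℝ) *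
            Real.sqrt ((T : ℝ) * Real.logb 2 ((T : ℝ) / ((K : ℝ) * (M : ℝ))))) := by
  have hpos := numSub_pos (K := K) (by omega) hM
  set H := numSub K M with hH
  set b := subBudget K M q with hb
  have hHM : H * M ≤ 4 * K := numSub_mul_le hM hMK
  have hKH : K ≤ H * M := le_numSub_mul_self hM hMK
  -- The current phase length is the time elapsed before the phase plus the length of the first
  -- phase. Each is at most `T`, the second by the lower bound on the horizon.
  have hHb : H * b ≤ 2 * T := by
    have h1 := numSub_mul_le_subStart K M (q / H)
    have h2 : subStart K M (q / H * H) ≤ subStart K M q :=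
      subStart_mono K M (Nat.div_mul_le_self _ _)
    have h3 : H * (M * (M + 2)) ≤ K * M ^ 2 * (M + 2) := by
      have h4 : H ≤ K * M := by nlinarith
      calc H * (M * (M + 2)) ≤ K * M * (M * (M + 2)) := Nat.mul_le_mul_right _ h4
        _ = _ := by ring
    have h5 : H * b = H * (M * (M + 2) * 2 ^ (q / H)) := rfl
    rw [← hH] at h1
    omega
  have hM2 : (2 : ℝ) ≤ M := by exact_mod_cast hM
  have hK0 : (0 : ℝ) < K := by exact_mod_cast (by omega : 0 < K)
  have hH1 : (1 : ℝ) ≤ H := by exact_mod_cast hpos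
  have hHM' : (H : ℝ) * M ≤ 4 * K := by exact_mod_cast hHM
  have hKH' : (K : ℝ) ≤ H * M := by exact_mod_cast hKH
  have hHb' : (H : ℝ) * b ≤ 2 * T := by exact_mod_cast hHb
  have hT' : (K : ℝ) * M ^ 2 * (M + 2) < T := by exact_mod_cast hT
  have hb1 : (1 : ℝ) ≤ b := by exact_mod_cast subBudget_pos hM K q
  have hT0 : (0 : ℝ) < T := lt_of_le_of_lt (by positivity) hT'
  set y : ℝ := T / (K * M) with hy
  have hyM : (M : ℝ) * (M + 2) ≤ y := by
    rw [hy, le_div_iff₀ (by positivity)]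
    nlinarith
  have hy8 : 8 ≤ y := by nlinarith
  -- The horizon bound gives `M ^ 2 ≤ y`, so `b ≤ 2 y M ^ 2` is polynomial in `y`; this lets `log b`
  -- be replaced by the logarithm of `T / (K M)`.
  have hby : (b : ℝ) ≤ y ^ 3 := by
    have h1 : (b : ℝ) * K ≤ 2 * T * M := by
      calc (b : ℝ) * K ≤ b * (H * M) := by gcongr
        _ = H * b * M := by ring
        _ ≤ 2 * T * M := by gcongr
    have h2 : (b : ℝ) ≤ 2 * y * M ^ 2 := by
      have h3 : 2 * y * (M : ℝ) ^ 2 = 2 * T * M / K := by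
        rw [hy]
        field_simp
      rw [h3, le_div_iff₀ hK0]
      exact h1
    have h4 : (M : ℝ) ^ 2 ≤ y := by nlinarith
    calc (b : ℝ) ≤ 2 * y * M ^ 2 := h2
      _ ≤ 2 * y * y := by gcongr
      _ ≤ y * y * y := by
          have : 0 ≤ y * y := by positivity
          nlinarith
      _ = y ^ 3 := by ring
  have hlogb : Real.log b ≤ 3 * Real.logb 2 y := by
    have h1 : Real.log b ≤ 3 * Real.log y := by
      have := Real.log_le_log (by linarith) hby
      rwa [Real.log_pow] at this
    have hlogy : 0 ≤ Real.log y := Real.log_nonneg (by linarith)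
    have hlog2 : 0 < Real.log 2 := Real.log_pos (by norm_num)
    have h2 : Real.log y ≤ Real.logb 2 y := by
      rw [Real.logb, le_div_iff₀ hlog2]
      have := Real.log_two_lt_d9
      nlinarith
    linarith
  have hell : 0 ≤ Real.logb 2 y := Real.logb_nonneg (by norm_num) (by linarith)
  have hlog0 : 0 ≤ Real.log b := Real.log_nonneg hb1
  have hfirst : (H : ℝ) * (M * (M + 2)) ≤ 8 * (K * M) := by
    calc (H : ℝ) * (M * (M + 2)) = H * M * (M + 2) := by ring
      _ ≤ 4 * K * (2 * M) := by gcongr; linarith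
      _ = 8 * (K * M) := by ring
  have hrpow : ((K : ℝ) ^ (3 / 2 : ℝ)) ^ 2 = (K : ℝ) ^ 3 := by
    rw [← Real.rpow_natCast, ← Real.rpow_mul hK0.le, ← Real.rpow_natCast]
    norm_num
  -- After squaring, one factor `H` joins `b` to give `2T` and the other three are bounded by `4 K /
  -- M`. The constant is `4 ^ 3 * 2 * 3 = 384 ≤ 20 ^ 2`.
  have hsecond : (H : ℝ) ^ 2 * Real.sqrt (M * b * Real.log b) ≤
      20 * ((K : ℝ) ^ (3 / 2 : ℝ) / M * Real.sqrt (T * Real.logb 2 y)) := by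
    refine abs_le_of_sq_le_sq' ?_ (by positivity) |>.2
    rw [mul_pow, mul_pow, mul_pow, div_pow, hrpow, Real.sq_sqrt (by positivity),
      Real.sq_sqrt (by positivity)]
    have hH4 : (H : ℝ) ≤ 4 * K / M := by
      rw [le_div_iff₀ (by linarith)]
      exact hHM'
    calc ((H : ℝ) ^ 2) ^ 2 * (M * b * Real.log b) = H ^ 3 * (M * (H * b) * Real.log b) := by ring
      _ ≤ (4 * K / M) ^ 3 * (M * (2 * T) * (3 * Real.logb 2 y)) := by gcongr
      _ = 384 * ((K : ℝ) ^ 3 / M ^ 2 * (T * Real.logb 2 y)) := by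
          field_simp
          ring
      _ ≤ 20 ^ 2 * ((K : ℝ) ^ 3 / M ^ 2 * (T * Real.logb 2 y)) := by
          gcongr
          norm_num
  have hKM : 0 ≤ (K : ℝ) * M := by positivity
  linarith

end Schedule

/-! ### Expected regret -/

section Regret

variable {Ω : Type*} {m0 : MeasurableSpace Ω} {P : Measure Ω} [IsProbabilityMeasure P] {K : ℕ}
  {ν : Fin K → Measure ℝ} {X : ℕ → Fin K → Ω → ℝ} [NeZero K] (tie : TieRule K)

/-- The memory is fixed during a sub-phase, so its loss against `c` is paid once per pull; the rest
is the regret of the UCB1 run. -/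
theorem sum_integral_gap_eq (h : IsRewardTable P ν X) (hprob : ∀ a, IsProbabilityMeasure (ν a))
    (hν : ∀ a, ν a (Set.Icc 0 1) = 1) {M : ℕ} (hM : 2 ≤ M) (hMK : M < K) (c : Fin K) (s : ℕ)
    {t : ℕ} (ht : t ≤ subBudget K M s) :
    ∑ v ∈ Finset.range t, ∫ ω, (armMean ν c -
        armMean ν (pulledIndex tie M (fun t a => X t a ω) (subStart K M s + v))) ∂P =
      t * ∫ ω, (armMean ν c -
        bestMean (armMean ν) (memory M (subState tie M (fun t a => X t a ω) s))) ∂P +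
      ∫ ω, ∑ v ∈ Finset.range t,
        (bestMean (armMean ν) (memory M (subState tie M (fun t c => X t c ω) s)) -
          armMean ν (ucb1Arm (fun u => tie.pull (subStart K M s + u))
            (memory M (subState tie M (fun t c => X t c ω) s))
            (fun u c => X (subStart K M s + u) c ω) v)) ∂P := by
  have hμ := fun a => (armMean_mem_Icc hprob hν a).1
  have hμ' := fun a => (armMean_mem_Icc hprob hν a).2
  have hS := measurable_memory tie h.measurable M s
  have hbest : Integrable (fun ω =>
      bestMean (armMean ν) (memory M (subState tie M (fun t a => X t a ω) s))) P :=
    integrable_bestMean hS hμ hμ'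
  have harm : ∀ v, Integrable (fun ω => armMean ν (ucb1Arm (fun u => tie.pull (subStart K M s + u))
      (memory M (subState tie M (fun t c => X t c ω) s))
      (fun u c => X (subStart K M s + u) c ω) v)) P := fun v =>
    integrable_comp_arm (measurable_ucb1Arm hS v fun w _ a => h.measurable _ a) _ hμ hμ'
  have hdiff : ∀ v, Integrable (fun ω =>
      bestMean (armMean ν) (memory M (subState tie M (fun t c => X t c ω) s)) -
        armMean ν (ucb1Arm (fun u => tie.pull (subStart K M s + u))
          (memory M (subState tie M (fun t c => X t c ω) s))
          (fun u c => X (subStart K M s + u) c ω) v)) P := fun v => hbest.sub (harm v)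
  rw [integral_finsetSum _ fun v _ => hdiff v, ← smul_eq_mul, Nat.cast_smul_eq_nsmul,
    ← Finset.card_range t, ← Finset.sum_const, Finset.card_range, ← Finset.sum_add_distrib]
  refine Finset.sum_congr rfl fun v hv => ?_
  have hloss : Integrable (fun ω => armMean ν c -
      bestMean (armMean ν) (memory M (subState tie M (fun t a => X t a ω) s))) P :=
    (integrable_const _).sub hbest
  rw [← integral_add hloss (hdiff v)]
  refine integral_congr_ae (Filter.Eventually.of_forall fun ω => ?_)
  simp only [pulledIndex_eq tie hM hMK _ ((Finset.mem_range.1 hv).trans_le ht)]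
  ring

/-- The expected regret within a sub-phase from the second phase on. -/
theorem sum_integral_gap_le (h : IsRewardTable P ν X) (hprob : ∀ a, IsProbabilityMeasure (ν a))
    (hν : ∀ a, ν a (Set.Icc 0 1) = 1) {M : ℕ} (hM : 2 ≤ M) (hMK : M < K) (c : Fin K) {s : ℕ}
    (hs : numSub K M ≤ s) {t : ℕ} (ht : t ≤ subBudget K M s) :
    ∑ v ∈ Finset.range t, ∫ ω, (armMean ν c -
        armMean ν (pulledIndex tie M (fun t a => X t a ω) (subStart K M s + v))) ∂P ≤
      120 * numSub K M * Real.sqrt (M * subBudget K M s * Real.log (subBudget K M s)) := by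
  have hpos := numSub_pos (K := K) (by omega) hM
  obtain ⟨w, hw⟩ : ∃ w, s / numSub K M = w + 1 :=
    ⟨s / numSub K M - 1, by have := Nat.div_pos hs hpos; omega⟩
  have hws : (w + 1) * numSub K M ≤ s := hw ▸ Nat.div_mul_le_self _ _
  have hsw : s < (w + 2) * numSub K M := by
    have := Nat.lt_succ_of_le (le_of_eq hw)
    exact (Nat.div_lt_iff_lt_mul hpos).1 this
  have hμ := fun a => (armMean_mem_Icc hprob hν a).1
  have hμ' := fun a => (armMean_mem_Icc hprob hν a).2
  have hbest : Integrable (fun ω =>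
      bestMean (armMean ν) (memory M (subState tie M (fun t a => X t a ω) s))) P :=
    integrable_bestMean (measurable_memory tie h.measurable M s) hμ hμ'
  set b := subBudget K M s with hb
  have hb1 : (1 : ℝ) ≤ b := by exact_mod_cast subBudget_pos hM K s
  have hlog : 0 ≤ Real.log b := Real.log_nonneg hb1
  have hM0 : (0 : ℝ) < M := by exact_mod_cast (by omega : 0 < M)
  set Q := Real.sqrt (M * b * Real.log b) with hQ
  have hQ0 : 0 ≤ Q := Real.sqrt_nonneg _
  have hloss : ∫ ω, (armMean ν c -
      bestMean (armMean ν) (memory M (subState tie M (fun t a => X t a ω) s))) ∂P ≤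
      2 * numSub K M * (44 * (Q / b)) := by
    calc _ ≤ ∫ ω, ∑ i ∈ Finset.Ico (w * numSub K M) s,
          simpleRegret tie M (fun t c => X t c ω) (armMean ν) i ∂P :=
          integral_mono ((integrable_const _).sub hbest)
            (integrable_finsetSum _ fun i _ => integrable_simpleRegret tie h hprob hν M i)
            fun ω => mean_sub_bestMean_le tie _ _ (by omega) hM c hws
      _ = ∑ i ∈ Finset.Ico (w * numSub K M) s,
          ∫ ω, simpleRegret tie M (fun t c => X t c ω) (armMean ν) i ∂P :=
          integral_finsetSum _ fun i _ => integrable_simpleRegret tie h hprob hν M i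
      _ ≤ ∑ i ∈ Finset.Ico (w * numSub K M) s, 44 * (Q / b) := by
          refine Finset.sum_le_sum fun i hi => ?_
          obtain ⟨hi1, hi2⟩ := Finset.mem_Ico.1 hi
          refine (integral_simpleRegret_le tie h hprob hν hM i).trans ?_
          have hbi : subBudget K M i ≤ b := subBudget_mono K M hi2.le
          -- Sub-phase `i` lies in the current or the previous phase, so its budget is at least half
          -- the current one.
          have hbi2 : b ≤ 2 * subBudget K M i := by
            have h1 : b = M * (M + 2) * 2 ^ (w + 1) := by rw [hb, subBudget, hw]
            have h2 : M * (M + 2) * 2 ^ w ≤ subBudget K M i :=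
              Nat.mul_le_mul_left _ (Nat.pow_le_pow_right two_pos
                ((Nat.le_div_iff_mul_le hpos).2 hi1))
            rw [h1, pow_succ]
            linarith
          have hbi0 : (0 : ℝ) < subBudget K M i := by exact_mod_cast subBudget_pos hM K i
          have hbiR : (subBudget K M i : ℝ) ≤ b := by exact_mod_cast hbi
          have hbi2R : (b : ℝ) ≤ 2 * subBudget K M i := by exact_mod_cast hbi2
          have hlogi : Real.log (subBudget K M i) ≤ Real.log b := Real.log_le_log hbi0 hbiR
          have hroot : Real.sqrt (M * Real.log (subBudget K M i) / subBudget K M i) ≤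
              2 * (Q / b) := by
            rw [Real.sqrt_le_left (by positivity), mul_pow, div_pow, hQ,
              Real.sq_sqrt (by positivity)]
            calc M * Real.log (subBudget K M i) / subBudget K M i
                ≤ M * Real.log b / (b / 2) := by
                  gcongr
                  linarith
              _ = 2 * (M * Real.log b / b) := by ring
              _ ≤ 4 * (M * Real.log b / b) := by
                  have : 0 ≤ M * Real.log b / b := by positivity
                  linarith
              _ = 2 ^ 2 * (M * b * Real.log b / b ^ 2) := by
                  field_simp
                  ring
          linarith
      _ ≤ 2 * numSub K M * (44 * (Q / b)) := by
          rw [Finset.sum_const, Nat.card_Ico, nsmul_eq_mul]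
          have hcard : s - w * numSub K M ≤ 2 * numSub K M := by
            have : (w + 2) * numSub K M = w * numSub K M + 2 * numSub K M := by ring
            omega
          have hcardR : ((s - w * numSub K M : ℕ) : ℝ) ≤ 2 * numSub K M := by
            exact_mod_cast hcard
          gcongr
  rw [sum_integral_gap_eq tie h hprob hν hM hMK c s ht]
  have hin := integral_subphase_regret_le tie h hprob hν hM s ht
  have htb : (t : ℝ) ≤ b := by exact_mod_cast ht
  have hfirst : (t : ℝ) * ∫ ω, (armMean ν c -
      bestMean (armMean ν) (memory M (subState tie M (fun t a => X t a ω) s))) ∂P ≤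
      88 * numSub K M * Q := by
    calc _ ≤ (t : ℝ) * (2 * numSub K M * (44 * (Q / b))) := by gcongr
      _ ≤ b * (2 * numSub K M * (44 * (Q / b))) := by gcongr
      _ = 88 * numSub K M * Q := by field_simp; ring
  have hh1 : (1 : ℝ) ≤ numSub K M := by exact_mod_cast hpos
  have hlast : 32 * Q ≤ 32 * numSub K M * Q := by nlinarith
  linarith

theorem sum_range_gap_le (h : IsRewardTable P ν X) (hprob : ∀ a, IsProbabilityMeasure (ν a))
    (hν : ∀ a, ν a (Set.Icc 0 1) = 1) {M : ℕ} (hM : 2 ≤ M) (hMK : M < K) (c : Fin K) {q u : ℕ}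
    (hu : u < subBudget K M q) :
    ∑ t ∈ Finset.range (subStart K M q + u), ∫ ω, (armMean ν c -
        armMean ν (pulledIndex tie M (fun t a => X t a ω) t)) ∂P ≤
      numSub K M * (M * (M + 2)) + 480 * (numSub K M : ℝ) ^ 2 *
        Real.sqrt (M * subBudget K M q * Real.log (subBudget K M q)) := by
  have hpos := numSub_pos (K := K) (by omega) hM
  set G : ℕ → ℝ := fun t => ∫ ω, (armMean ν c -
        armMean ν (pulledIndex tie M (fun t a => X t a ω) t)) ∂P with hG
  set R := Real.sqrt (M * Real.log (subBudget K M q)) with hR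
  -- A majorant for each sub-phase: pulls of the first phase are charged one each, and in later
  -- phases the logarithm is frozen at its final value so that only `√b` varies.
  set F : ℕ → ℝ := fun s => (if s < numSub K M then (M * (M + 2) : ℝ) else 0) +
    120 * numSub K M * R * Real.sqrt (subBudget K M s) with hF
  have hG1 : ∀ t, G t ≤ 1 := by
    intro t
    have hμ := fun a => (armMean_mem_Icc hprob hν a).1
    have hμ' := fun a => (armMean_mem_Icc hprob hν a).2
    by_cases hint : Integrable (fun ω => armMean ν c -
        armMean ν (pulledIndex tie M (fun t a => X t a ω) t)) P
    · calc G t ≤ ∫ _, (1 : ℝ) ∂P := integral_mono hint (integrable_const _) fun ω => by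
            have := hμ' c
            have := hμ (pulledIndex tie M (fun t a => X t a ω) t)
            show armMean ν c - _ ≤ 1
            linarith
        _ = 1 := by simp
    -- A non-integrable integrand has integral zero by convention, so integrability need not be
    -- proved here.
    · simp only [hG]
      rw [integral_undef hint]
      exact zero_le_one
  have hblock : ∀ s ≤ q, ∀ t ≤ subBudget K M s,
      ∑ v ∈ Finset.range t, G (subStart K M s + v) ≤ F s := by
    intro s hsq t ht
    have hb1 : (1 : ℝ) ≤ subBudget K M s := by exact_mod_cast subBudget_pos hM K s
    have hle : (subBudget K M s : ℝ) ≤ subBudget K M q := by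
      exact_mod_cast subBudget_mono K M hsq
    by_cases hs : s < numSub K M
    · have hbs : subBudget K M s = M * (M + 2) := by
        simp [subBudget, Nat.div_eq_of_lt hs]
      have h1 : ∑ v ∈ Finset.range t, G (subStart K M s + v) ≤ ∑ v ∈ Finset.range t, (1 : ℝ) :=
        Finset.sum_le_sum fun v _ => hG1 _
      have h2 : (t : ℝ) ≤ M * (M + 2) := by
        rw [hbs] at ht
        exact_mod_cast ht
      have h3 : 0 ≤ 120 * numSub K M * R * Real.sqrt (subBudget K M s) := by positivity
      simp only [hF, if_pos hs]
      simp only [Finset.sum_const, Finset.card_range, nsmul_eq_mul, mul_one] at h1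
      linarith
    · simp only [hF, if_neg hs, zero_add]
      refine (sum_integral_gap_le tie h hprob hν hM hMK c (not_lt.1 hs) ht).trans ?_
      rw [mul_assoc (120 * (numSub K M : ℝ)), hR, ← Real.sqrt_mul (mul_nonneg (Nat.cast_nonneg _)
        (Real.log_natCast_nonneg _))]
      have hlog : Real.log (subBudget K M s) ≤ Real.log (subBudget K M q) :=
        Real.log_le_log (by linarith) hle
      refine mul_le_mul_of_nonneg_left (Real.sqrt_le_sqrt ?_) (by positivity)
      calc (M : ℝ) * subBudget K M s * Real.log (subBudget K M s)
          ≤ M * subBudget K M s * Real.log (subBudget K M q) := by gcongr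
        _ = _ := by ring
  have hprefix : ∀ s ≤ q, ∑ t ∈ Finset.range (subStart K M s), G t ≤ ∑ r ∈ Finset.range s, F r := by
    intro s hs
    induction s with
    | zero => simp [subStart]
    | succ s ih =>
      rw [subStart_succ, Finset.sum_range_add, Finset.sum_range_succ]
      exact add_le_add (ih (by omega)) (hblock s (by omega) _ le_rfl)
  set w := q / numSub K M with hw
  have hqw : q < (w + 1) * numSub K M := by
    exact (Nat.div_lt_iff_lt_mul hpos).1 (Nat.lt_succ_self _)
  have hF0 : ∀ s, 0 ≤ F s := by
    intro s
    simp only [hF]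
    split_ifs <;> positivity
  calc ∑ t ∈ Finset.range (subStart K M q + u), G t
      ≤ ∑ r ∈ Finset.range (q + 1), F r := by
        rw [Finset.sum_range_add, Finset.sum_range_succ]
        exact add_le_add (hprefix q le_rfl) (hblock q le_rfl _ hu.le)
    -- The unfinished phase is completed, so that the sum runs over whole phases.
    _ ≤ ∑ r ∈ Finset.range ((w + 1) * numSub K M), F r :=
        Finset.sum_le_sum_of_subset_of_nonneg (Finset.range_mono hqw) fun s _ _ => hF0 s
    _ = numSub K M * (M * (M + 2)) + 120 * numSub K M * R *
          ∑ s ∈ Finset.range ((w + 1) * numSub K M), Real.sqrt (subBudget K M s) := by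
        simp only [hF]
        rw [Finset.sum_add_distrib, ← Finset.mul_sum, ← Finset.sum_filter]
        have hfil : (Finset.range ((w + 1) * numSub K M)).filter (fun s => s < numSub K M) =
            Finset.range (numSub K M) := by
          ext s
          have : numSub K M ≤ (w + 1) * numSub K M := Nat.le_mul_of_pos_left _ w.succ_pos
          simp only [Finset.mem_filter, Finset.mem_range]
          omega
        rw [hfil]
        simp
    _ ≤ numSub K M * (M * (M + 2)) + 120 * numSub K M * R *
          (4 * numSub K M * Real.sqrt (subBudget K M q)) := by
        have := sum_sqrt_subBudget_le K M w
        have hbq : subBudget K M q = M * (M + 2) * 2 ^ w := rfl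
        rw [hbq]
        gcongr
    _ = numSub K M * (M * (M + 2)) + 480 * (numSub K M : ℝ) ^ 2 *
        Real.sqrt (M * subBudget K M q * Real.log (subBudget K M q)) := by
        have : Real.sqrt (M * subBudget K M q * Real.log (subBudget K M q)) =
            R * Real.sqrt (subBudget K M q) := by
          rw [hR, ← Real.sqrt_mul (mul_nonneg (Nat.cast_nonneg _) (Real.log_natCast_nonneg _))]
          congr 1
          ring
        rw [this]
        ring

theorem measurable_pulledIndex (hX : ∀ t a, Measurable (X t a)) (M : ℕ) (t : ℕ) :
    Measurable fun ω => pulledIndex tie M (fun t a => X t a ω) t := by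
  unfold pulledIndex
  split_ifs
  · exact measurable_ucb1Arm measurable_const t fun v _ a => hX v a
  · exact measurable_ucb1Arm (measurable_memory tie hX M _) _ fun v _ a => hX _ a

/-- The regret for a given shuffle. -/
theorem sum_sub_integral_pulledArm_le (h : IsRewardTable P ν X)
    (hprob : ∀ a, IsProbabilityMeasure (ν a)) (hν : ∀ a, ν a (Set.Icc 0 1) = 1) {M T : ℕ}
    (hM : 2 ≤ M) (hMK : M < K) (hT : K * M ^ 2 * (M + 2) < T) (σ : Equiv.Perm (Fin K)) :
    T * (⨆ a, armMean ν a) - ∑ t ∈ Finset.range T,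
        ∫ ω, armMean ν (pulledArm tie M σ (fun v a => X v a ω) t) ∂P ≤
      9600 * ((K : ℝ) * (M : ℝ) + (K : ℝ) ^ (3 / 2 : ℝ) / (M : ℝ) *
            Real.sqrt ((T : ℝ) * Real.logb 2 ((T : ℝ) / ((K : ℝ) * (M : ℝ))))) := by
  obtain ⟨q, u, hq, hu⟩ := exists_eq_subStart_add hM K T
  obtain ⟨a, ha⟩ := exists_eq_ciSup_of_finite (f := armMean ν)
  have hmean : ∀ i, armMean (fun i => ν (σ i)) i = armMean ν (σ i) := fun _ => rfl
  -- Relabelling by `σ` gives another reward table, in which the optimal arm `a` has index `σ.symm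
  -- a`.
  have hbound := sum_range_gap_le tie (h.comp_perm σ) (fun i => hprob (σ i)) (fun i => hν (σ i)) hM
    hMK (σ.symm a) hu
  rw [← hq] at hbound
  refine le_trans (le_of_eq ?_) (hbound.trans (schedule_bound hM hMK hT hq))
  rw [← ha, ← smul_eq_mul, Nat.cast_smul_eq_nsmul]
  nth_rewrite 1 [← Finset.card_range T]
  rw [← Finset.sum_const, ← Finset.sum_sub_distrib]
  refine Finset.sum_congr rfl fun t _ => ?_
  have hint : Integrable (fun ω => armMean (fun i => ν (σ i))
      (pulledIndex tie M (fun t i => X t (σ i) ω) t)) P :=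
    integrable_comp_arm (measurable_pulledIndex tie (h.comp_perm σ).measurable M t) _
      (fun i => (armMean_mem_Icc hprob hν (σ i)).1) (fun i => (armMean_mem_Icc hprob hν (σ i)).2)
  rw [integral_sub (integrable_const _) hint]
  simp [hmean, pulledArm]

end Regret

end UCBM

/-! ### Averaging over the shuffle -/

theorem theorem2 :
    ∃ C : ℝ, 0 < C ∧
      ∀ (K M T : ℕ) [NeZero K], 3 ≤ K → 2 ≤ M → M < K → K * M ^ 2 * (M + 2) < T →
      ∀ (tie : UCBM.TieRule K) (ν : Fin K → MeasureTheory.Measure ℝ),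
        (∀ a, MeasureTheory.IsProbabilityMeasure (ν a)) → (∀ a, ν a (Set.Icc 0 1) = 1) →
      ∀ (Ω : Type*) [MeasurableSpace Ω] (P : MeasureTheory.Measure Ω)
        [MeasureTheory.IsProbabilityMeasure P] (X : ℕ → Fin K → Ω → ℝ),
        UCBM.IsRewardTable P ν X →
        UCBM.regret P ν X tie M T ≤
          C * ((K : ℝ) * (M : ℝ) + (K : ℝ) ^ (3 / 2 : ℝ) / (M : ℝ) *
            Real.sqrt ((T : ℝ) * Real.logb 2 ((T : ℝ) / ((K : ℝ) * (M : ℝ))))) := by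
  refine ⟨9600, by norm_num, ?_⟩
  intro K M T _ _ hM hMK hT tie ν hprob hν Ω _ P _ X h
  have hfact : (0 : ℝ) < K.factorial := by exact_mod_cast K.factorial_pos
  -- The bound is the same for every shuffle, so it passes to the average over all `K!`
  -- permutations.
  have hσ := Finset.sum_le_sum fun (σ : Equiv.Perm (Fin K)) (_ : σ ∈ Finset.univ) =>
    UCBM.sum_sub_integral_pulledArm_le tie h hprob hν hM hMK hT σ
  rw [Finset.sum_sub_distrib, Finset.sum_comm] at hσ
  simp only [Finset.sum_const, Finset.card_univ, Fintype.card_perm, Fintype.card_fin,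
    nsmul_eq_mul] at hσ
  unfold UCBM.regret
  rw [← Finset.sum_div, sub_le_iff_le_add, ← sub_le_iff_le_add', le_div_iff₀ hfact]
  linarith
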